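/- Let $a\neq b$ be points of the unit circle $\mathbb T$; $[a,b]$ and $(a,b)$ denote the closed and open arcs of $\mathbb T$ running counterclockwise from $a$ to $b$ (and likewise $(u,v)$ for other $u,v\in\mathbb T$). Let $\mu$ be a finite positive Borel measure with $\mu(\mathbb C\setminus[a,b])=0$ whose support is infinite, with inner product $\langle P,R\rangle_\mu=\int P\,\overline{R}\,d\mu$ and monic orthogonal polynomials $\rho_k$ ($\deg\rho_k=k$). For a polynomial $P$ of degree $k$ put $P^*(z)=z^k\,\overline{P(1/\overline z)}$, and for $k\ge1$ put $F_k(z)=z\rho_{k-1}(z)/\rho_{k-1}^*(z)$. Let $$d\hat\mu(z)=\sqrt{\overline{ab}}\,(z-a)(z-b)\,\overline z\,d\mu(z),$$ where the square root is the one for which the density is positive on $(a,b)$; let $\hat\rho_k$ be the monic orthogonal polynomials of $\hat\mu$ and $\hat F_k(z)=z\hat\rho_{k-1}(z)/\hat\rho_{k-1}^*(z)$. Let $n\ge3$, $\tau\in\mathbb T$, $\hat\tau=\overline{ab}\,\tau$, $f_a=\overline{F_{n-1}(a)}$, $f_b=\overline{F_{n-1}(b)}$. Then $af_a\ne bf_b$.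 Put $\eta=c_{12}+ab\,\hat\tau\,a_{12}$, where $$\overline{c_{12}}=\frac{f_a-f_b}{af_a-bf_b},\qquad \overline{a_{12}}=\frac{a-b}{af_a-bf_b},$$ and $$Q_{n,3}(z)=z(z-\eta)\rho_{n-2}(z)+\tau(1-\overline\eta z)\rho_{n-2}^*(z).$$ Then $Q_{n,3}$ is a monic $\tau$-invariant quasi-paraorthogonal polynomial of degree $n$ and order $3$ for $\mu$, i.e. it is monic of degree $n$, $Q_{n,3}=\tau Q_{n,3}^*$, and $\langle Q_{n,3},z^k\rangle_\mu=0$ for $2\le k\le n-2$. Moreover: 1. All zeros of $Q_{n,3}$ are simple and lie in $[a,b]$, with $a$ and $b$ among them, if and only if $-\hat\tau\in(\hat F_{n-2}(a),\hat F_{n-2}(b))$. 2. For every $\alpha\in(a,b)$: all zeros of $Q_{n,3}$ are simple and lie in $[a,b]$, with $a$, $b$ and $\alpha$ among them, if and only if $-\hat\tau=\hat F_{n-2}(\alpha)$ and $\hat F_{n-2}(\alpha)\in(\hat F_{n-2}(a),\hat F_{n-2}(b))$. -/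

import Mathlib

open MeasureTheory Polynomial
open scoped ComplexConjugate ComplexOrder

noncomputable section

namespace QPOPUC

/-- The open arc `(u, v)` of the unit circle, running counterclockwise from `u` to `v`
(for `u`, `v` on the circle; empty when `u = v`). -/
def openArc (u v : ℂ) : Set ℂ :=
  {z | ∃ x y : ℝ, 0 < x ∧ x < y ∧ y < 2 * Real.pi ∧
    z = u * Complex.exp (x * Complex.I) ∧ v = u * Complex.exp (y * Complex.I)}

/-- The closed arc `[u, v]` of the unit circle, running counterclockwise from `u` to `v`
(for `u`, `v` on the circle; the single point `u` when `u = v`). -/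
def closedArc (u v : ℂ) : Set ℂ :=
  {z | ∃ x y : ℝ, 0 ≤ x ∧ x ≤ y ∧ y < 2 * Real.pi ∧
    z = u * Complex.exp (x * Complex.I) ∧ v = u * Complex.exp (y * Complex.I)}

/-- The inner product `⟨P, R⟩ = ∫ P(z) conj(R(z)) dμ(z)` induced by `μ` on polynomials. -/
def innerProd (μ : Measure ℂ) (P R : ℂ[X]) : ℂ :=
  ∫ z, P.eval z * conj (R.eval z) ∂μ

/-- The monic orthogonal polynomials `ρ_n` of `μ`, obtained from `1, z, z², …` by the
(unnormalized) Gram-Schmidt process. -/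
def rho (μ : Measure ℂ) : ℕ → ℂ[X]
  | n => X ^ n - ∑ k : Fin n,
      C (innerProd μ (X ^ n) (rho μ k) / innerProd μ (rho μ k) (rho μ k)) * rho μ k
  termination_by n => n
  decreasing_by all_goals exact k.2

/-- The reciprocal `P^*(z) = z^n conj(P(1 / conj z))` of a polynomial `P` of degree at most `n`:
the coefficient of `z^k` in `P^*` is the conjugate of that of `z^(n-k)` in `P`. -/
def recip (n : ℕ) (P : ℂ[X]) : ℂ[X] :=
  (P.map (starRingEnd ℂ)).reflect n

/-- The Blaschke product `F_k(z) = z ρ_{k-1}(z) / ρ_{k-1}^*(z)`, for `k ≥ 1`. -/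
def blaschke (μ : Measure ℂ) (k : ℕ) (z : ℂ) : ℂ :=
  z * (rho μ (k - 1)).eval z / (recip (k - 1) (rho μ (k - 1))).eval z

/-- `Q` is a monic `τ`-invariant quasi-paraorthogonal polynomial of degree `n` and order `2ℓ+1`
for `μ`: it is monic of degree `n`, satisfies `Q = τ Q^*` with `|τ| = 1`, and is orthogonal to
`z^k` for `ℓ + 1 ≤ k ≤ n - ℓ - 1`. -/
structure IsMonicQPOPUC (μ : Measure ℂ) (n ℓ : ℕ) (τ : ℂ) (Q : ℂ[X]) : Prop where
  monic : Q.Monic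
  natDegree_eq : Q.natDegree = n
  norm_param : ‖τ‖ = 1
  invariant : Q = C τ * recip n Q
  orthogonal : ∀ k : ℕ, ℓ + 1 ≤ k → k + ℓ + 1 ≤ n → innerProd μ Q (X ^ k) = 0

/-- The polynomial `Q_{n,3}(z) = z (z - η) ρ_{n-2}(z) + τ (1 - conj(η) z) ρ_{n-2}^*(z)`. -/
def Qn3 (μ : Measure ℂ) (n : ℕ) (η τ : ℂ) : ℂ[X] :=
  X * (X - C η) * rho μ (n - 2) +
    C τ * (1 - C (conj η) * X) * recip (n - 2) (rho μ (n - 2))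

/-- The modified measure `s (z - a) (z - b) conj(z) dμ(z)`. It is used with `s` a square root of
`conj(a b)` that makes the density positive on the open arc `(a, b)`. -/
def modifiedMeasure (μ : Measure ℂ) (a b s : ℂ) : Measure ℂ :=
  μ.withDensity fun z => ENNReal.ofReal (s * (z - a) * (z - b) * conj z).re

/-- All zeros of `Q` are simple and lie in `S`. -/
def AllZerosSimpleIn (Q : ℂ[X]) (S : Set ℂ) : Prop :=
  ∀ z : ℂ, Q.IsRoot z → Q.rootMultiplicity z = 1 ∧ z ∈ S

end QPOPUC

end

open QPOPUC

noncomputable section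

/-! The choice of `η` solves the two equations `(z - η) F_{n-1}(z) + τ (1 - conj η z) = 0` at `z =
a` and `z = b`, so `Q = (z - a)(z - b) R` in every case. Since `⟨P, S⟩` for the modified measure is
`s ⟨(z - a)(z - b) P, z S⟩` for `μ`, the orthogonality and invariance of `Q` make `R` the
paraorthogonal polynomial of the modified measure with parameter `-τhat` (`cofactor_eq_popuc`). The
zeros of `Q` are then simple and in `[a, b]` exactly when those of `R` lie in `(a, b)`, and the
zeros of `R` on the circle are the solutions of `F̂_{n-2} = -τhat`.

It remains to see when a paraorthogonal polynomial has all its zeros in `(a, b)`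
(`popuc_roots_mem_openArc_iff`). Two zeros outside the open arc are impossible: on the arc, `(z -
w₁)(z - w₂) conj z` has constant phase, which contradicts orthogonality
(`innerProd_two_roots_ne_zero`). The partial fractions of `F / (F - c)` have positive weights; their
imaginary parts write a half-angle cotangent of `F(z)` as a positive combination of half-angle
cotangents of `z` seen from the zeros (`exists_quadrature`). As these cotangents encode cyclic
order, the position of the zeros relative to `a`, `b` is carried over to that of `c` relative to
`F(a)`, `F(b)`. -/

namespace QPOPUC

/-! ### Measures on an arc and their inner product -/

/-- A measure carried by the closed arc `[a, b]` of the unit circle but by no finite set. -/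
structure ArcMeasure (ν : Measure ℂ) (a b : ℂ) : Prop where
  norm_left : ‖a‖ = 1
  norm_right : ‖b‖ = 1
  ne : a ≠ b
  carrier : ν (closedArc a b)ᶜ = 0
  infinite : ∀ T : Set ℂ, T.Finite → ν Tᶜ ≠ 0

lemma norm_exp_real_mul_I (x : ℝ) : ‖Complex.exp (x * Complex.I)‖ = 1 :=
  Complex.norm_exp_ofReal_mul_I x

lemma norm_of_mem_closedArc {a b z : ℂ} (ha : ‖a‖ = 1) (hz : z ∈ closedArc a b) : ‖z‖ = 1 := by
  obtain ⟨x, y, -, -, -, rfl, -⟩ := hz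
  rw [norm_mul, ha, norm_exp_real_mul_I, one_mul]

lemma mul_conj_of_norm {z : ℂ} (hz : ‖z‖ = 1) : z * conj z = 1 := by
  rw [Complex.mul_conj, Complex.normSq_eq_norm_sq, hz]; simp

lemma conj_eq_inv_of_norm {z : ℂ} (hz : ‖z‖ = 1) : conj z = z⁻¹ :=
  eq_inv_of_mul_eq_one_right (mul_conj_of_norm hz)

lemma ne_zero_of_norm {z : ℂ} (hz : ‖z‖ = 1) : z ≠ 0 := by
  rintro rfl; simp at hz

namespace ArcMeasure

variable {ν : Measure ℂ} {a b : ℂ}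

lemma ae_mem (h : ArcMeasure ν a b) : ∀ᵐ z ∂ν, z ∈ closedArc a b := h.carrier

lemma ae_norm (h : ArcMeasure ν a b) : ∀ᵐ z ∂ν, ‖z‖ = 1 :=
  h.ae_mem.mono fun _ hz => norm_of_mem_closedArc h.norm_left hz

variable [IsFiniteMeasure ν]

lemma integrable (h : ArcMeasure ν a b) {f : ℂ → ℂ} (hf : Continuous f) : Integrable f ν := by
  obtain ⟨C, hC⟩ := (isCompact_sphere (0 : ℂ) 1).exists_bound_of_continuousOn hf.continuousOn
  refine Integrable.of_bound hf.aestronglyMeasurable C (h.ae_norm.mono fun z hz => hC z ?_)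
  simpa using hz

/-- A nonnegative function with zero integral vanishes almost everywhere, so the measure would be
carried by the finite set `T`. All contradictions with orthogonality below end here. -/
lemma integral_ne_zero (h : ArcMeasure ν a b) {f : ℂ → ℂ} (hf : Continuous f)
    (hpos : ∀ z ∈ closedArc a b, 0 ≤ f z) {T : Set ℂ} (hT : T.Finite)
    (h0 : ∀ z ∈ closedArc a b, f z = 0 → z ∈ T) : ∫ z, f z ∂ν ≠ 0 := by
  intro hint
  have hre : ∫ z, (f z).re ∂ν = 0 := by
    have := integral_re (h.integrable hf)
    simp only [RCLike.re_eq_complex_re] at this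
    rw [this, hint]; simp
  rw [integral_eq_zero_iff_of_nonneg_ae] at hre
  · refine h.infinite T hT ?_
    change ∀ᵐ z ∂ν, z ∈ T
    filter_upwards [hre, h.ae_mem] with z hz hza
    refine h0 z hza (Complex.ext (by simpa using hz) ?_)
    exact (Complex.nonneg_iff.1 (hpos z hza)).2.symm
  · filter_upwards [h.ae_mem] with z hza
    exact (Complex.nonneg_iff.1 (hpos z hza)).1
  · exact (h.integrable hf).re

lemma continuous_integrand (P R : ℂ[X]) : Continuous fun z => P.eval z * conj (R.eval z) :=
  P.continuous.mul (Complex.continuous_conj.comp R.continuous)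

lemma innerProd_add_left (h : ArcMeasure ν a b) (P P' R : ℂ[X]) :
    innerProd ν (P + P') R = innerProd ν P R + innerProd ν P' R := by
  unfold innerProd
  rw [← integral_add (h.integrable (continuous_integrand P R))
    (h.integrable (continuous_integrand P' R))]
  simp only [eval_add, add_mul]

end ArcMeasure

lemma innerProd_C_mul_left (ν : Measure ℂ) (c : ℂ) (P R : ℂ[X]) :
    innerProd ν (C c * P) R = c * innerProd ν P R := by
  unfold innerProd
  rw [← integral_const_mul]
  simp only [eval_mul, eval_C, mul_assoc]

lemma innerProd_conj_symm (ν : Measure ℂ) (P R : ℂ[X]) :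
    conj (innerProd ν P R) = innerProd ν R P := by
  unfold innerProd
  rw [← integral_conj]
  simp only [map_mul, Complex.conj_conj, mul_comm]

lemma innerProd_C_mul_right (ν : Measure ℂ) (c : ℂ) (P R : ℂ[X]) :
    innerProd ν P (C c * R) = conj c * innerProd ν P R := by
  rw [← innerProd_conj_symm, innerProd_C_mul_left, map_mul, innerProd_conj_symm]

lemma innerProd_zero_left (ν : Measure ℂ) (R : ℂ[X]) : innerProd ν 0 R = 0 := by
  simp [innerProd]

/-! ### Reciprocal polynomials -/

lemma recip_eval {n : ℕ} {P : ℂ[X]} (hP : P.natDegree ≤ n) {z : ℂ} (hz : z ≠ 0) :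
    (recip n P).eval z = z ^ n * conj (P.eval (conj z)⁻¹) := by
  have hz' : conj z ≠ 0 := by simpa using hz
  let _ : Invertible z := invertibleOfNonzero hz
  have h := eval₂_reflect_mul_pow (RingHom.id ℂ) z n (recip n P) (by
    unfold recip
    refine natDegree_reflect_le.trans ?_
    simpa using hP)
  have h2 : reflect n (recip n P) = P.map (starRingEnd ℂ) := by
    simp [recip]
  rw [h2] at h
  change _ = eval z _ at h
  rw [← h, mul_comm, eval₂_id, invOf_eq_inv]
  congr 1
  rw [eval_map, ← eval₂_at_apply]
  simp

lemma recip_eval_of_norm {n : ℕ} {P : ℂ[X]} (hP : P.natDegree ≤ n) {z : ℂ} (hz : ‖z‖ = 1) :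
    (recip n P).eval z = z ^ n * conj (P.eval z) := by
  rw [recip_eval hP (ne_zero_of_norm hz), conj_eq_inv_of_norm hz, inv_inv]

lemma recip_coeff_zero (n : ℕ) (P : ℂ[X]) : (recip n P).coeff 0 = conj (P.coeff n) := by
  simp [recip, coeff_reflect]

lemma natDegree_recip_le {n : ℕ} {P : ℂ[X]} (hP : P.natDegree ≤ n) :
    (recip n P).natDegree ≤ n := by
  unfold recip
  refine natDegree_reflect_le.trans ?_
  simpa using hP

lemma recip_recip (n : ℕ) (P : ℂ[X]) : recip n (recip n P) = P := by
  simp [recip, reflect_map, Polynomial.map_map]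

lemma recip_add (n : ℕ) (P R : ℂ[X]) : recip n (P + R) = recip n P + recip n R := by
  simp [recip, reflect_add]

lemma recip_C_mul (n : ℕ) (c : ℂ) (P : ℂ[X]) : recip n (C c * P) = C (conj c) * recip n P := by
  simp [recip, reflect_C_mul]

lemma recip_mul {m n : ℕ} {P R : ℂ[X]} (hP : P.natDegree ≤ m) (hR : R.natDegree ≤ n) :
    recip (m + n) (P * R) = recip m P * recip n R := by
  unfold recip
  rw [Polynomial.map_mul, reflect_mul] <;> simpa

lemma recip_X : recip 1 X = 1 := by
  ext k
  rcases k with _ | _ | k <;> simp [recip, coeff_one]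

lemma recip_X_sub_C (w : ℂ) : recip 1 (X - C w) = 1 - C (conj w) * X := by
  ext k
  rcases k with _ | _ | k <;> simp [recip, coeff_X, coeff_one, coeff_C]

namespace ArcMeasure

variable {ν : Measure ℂ} {a b : ℂ} [IsFiniteMeasure ν]

lemma innerProd_add_right (h : ArcMeasure ν a b) (P R R' : ℂ[X]) :
    innerProd ν P (R + R') = innerProd ν P R + innerProd ν P R' := by
  rw [← innerProd_conj_symm, h.innerProd_add_left, map_add, innerProd_conj_symm,
    innerProd_conj_symm]

lemma innerProd_sub_left (h : ArcMeasure ν a b) (P P' R : ℂ[X]) :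
    innerProd ν (P - P') R = innerProd ν P R - innerProd ν P' R := by
  have := h.innerProd_add_left P (C (-1) * P') R
  rw [innerProd_C_mul_left] at this
  rw [show P - P' = P + C (-1) * P' by simp [sub_eq_add_neg], this]
  ring

lemma innerProd_sum_left (h : ArcMeasure ν a b) {ι : Type*} (s : Finset ι) (P : ι → ℂ[X])
    (R : ℂ[X]) : innerProd ν (∑ i ∈ s, P i) R = ∑ i ∈ s, innerProd ν (P i) R := by
  classical
  induction s using Finset.induction_on with
  | empty => simp [innerProd_zero_left]
  | insert i s hi ih => rw [Finset.sum_insert hi, Finset.sum_insert hi, h.innerProd_add_left, ih]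

lemma innerProd_self_ne_zero (h : ArcMeasure ν a b) {P : ℂ[X]} (hP : P ≠ 0) :
    innerProd ν P P ≠ 0 := by
  refine h.integral_ne_zero (continuous_integrand P P) (fun z _ => mul_star_self_nonneg _)
    (T := {z | P.IsRoot z}) (finite_setOfPred_isRoot hP) fun z _ hz => ?_
  simpa using hz

lemma innerProd_self_pos (h : ArcMeasure ν a b) {P : ℂ[X]} (hP : P ≠ 0) :
    0 < innerProd ν P P := by
  refine lt_of_le_of_ne ?_ (h.innerProd_self_ne_zero hP).symm
  unfold innerProd
  simp_rw [Complex.mul_conj]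
  rw [integral_complex_ofReal]
  exact_mod_cast integral_nonneg fun z => Complex.normSq_nonneg _

end ArcMeasure

namespace ArcMeasure

variable {ν : Measure ℂ} {a b : ℂ}

lemma innerProd_X_mul_X_mul (h : ArcMeasure ν a b) (P R : ℂ[X]) :
    innerProd ν (X * P) (X * R) = innerProd ν P R := by
  refine integral_congr_ae (h.ae_norm.mono fun z hz => ?_)
  simp only [eval_mul, eval_X, map_mul]
  linear_combination (eval z P * conj (eval z R)) * mul_conj_of_norm hz

lemma innerProd_recip_X_pow (h : ArcMeasure ν a b) {n k : ℕ} {P : ℂ[X]} (hP : P.natDegree ≤ n)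
    (hk : k ≤ n) : innerProd ν (recip n P) (X ^ k) = innerProd ν (X ^ (n - k)) P := by
  refine integral_congr_ae (h.ae_norm.mono fun z hz => ?_)
  simp only [eval_pow, eval_X, map_pow, recip_eval_of_norm hP hz]
  obtain ⟨j, rfl⟩ := Nat.exists_eq_add_of_le hk
  have := congrArg (· ^ k) (mul_conj_of_norm hz)
  simp only [mul_pow, one_pow] at this
  rw [Nat.add_sub_cancel_left, pow_add]
  linear_combination (z ^ j * conj (eval z P)) * this

end ArcMeasure

/-! ### Orthogonality relations of `ρ_n` and `ρ_n^*` -/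

lemma rho_eq (ν : Measure ℂ) (n : ℕ) : rho ν n = X ^ n - ∑ k : Fin n,
    C (innerProd ν (X ^ n) (rho ν k) / innerProd ν (rho ν k) (rho ν k)) * rho ν k := by
  rw [rho]

lemma rho_monic_and_natDegree (ν : Measure ℂ) (n : ℕ) :
    (rho ν n).Monic ∧ (rho ν n).natDegree = n := by
  induction n using Nat.strong_induction_on with
  | _ n ih =>
    have hdeg : (∑ k : Fin n, C (innerProd ν (X ^ n) (rho ν k) /
        innerProd ν (rho ν k) (rho ν k)) * rho ν k).degree < (n : WithBot ℕ) := by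
      refine (degree_sum_le _ _).trans_lt ((Finset.sup_lt_iff (WithBot.bot_lt_coe n)).2 fun k _ => ?_)
      refine (degree_mul_le_of_le degree_C_le le_rfl).trans_lt ?_
      rw [zero_add, degree_eq_natDegree (ih k k.2).1.ne_zero, (ih k k.2).2]
      exact Nat.cast_lt.2 k.2
    rw [rho_eq]
    refine ⟨monic_X_pow_sub hdeg, ?_⟩
    have := degree_sub_eq_left_of_degree_lt (p := (X : ℂ[X]) ^ n) (by simpa using hdeg)
    rw [natDegree, this]
    simp

lemma rho_monic (ν : Measure ℂ) (n : ℕ) : (rho ν n).Monic := (rho_monic_and_natDegree ν n).1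

lemma natDegree_rho (ν : Measure ℂ) (n : ℕ) : (rho ν n).natDegree = n :=
  (rho_monic_and_natDegree ν n).2

namespace ArcMeasure

variable {ν : Measure ℂ} {a b : ℂ} [IsFiniteMeasure ν]

lemma innerProd_rho_rho_of_lt (h : ArcMeasure ν a b) {k n : ℕ} (hk : k < n) :
    innerProd ν (rho ν n) (rho ν k) = 0 := by
  induction n using Nat.strong_induction_on generalizing k with
  | _ n ih =>
    have horth : ∀ i j, i < n → j < n → i ≠ j → innerProd ν (rho ν i) (rho ν j) = 0 := by
      intro i j hi hj hij
      rcases lt_or_gt_of_ne hij with hlt | hlt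
      · rw [← innerProd_conj_symm, ih j hj hlt, map_zero]
      · exact ih i hi hlt
    rw [rho_eq ν n, h.innerProd_sub_left, h.innerProd_sum_left,
      Finset.sum_eq_single (⟨k, hk⟩ : Fin n)]
    · rw [innerProd_C_mul_left, div_mul_cancel₀ _ (h.innerProd_self_ne_zero (rho_monic ν k).ne_zero),
        sub_self]
    · intro j _ hj
      rw [innerProd_C_mul_left, horth j k j.2 hk (fun hjk => hj (Fin.ext hjk)), mul_zero]
    · simp

lemma innerProd_rho_of_natDegree_lt (h : ArcMeasure ν a b) {n : ℕ} {P : ℂ[X]}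
    (hP : P.degree < n) : innerProd ν (rho ν n) P = 0 := by
  induction hd : P.degree using WellFoundedLT.induction generalizing P with
  | _ d ih =>
    by_cases h0 : P = 0
    · rw [h0, ← innerProd_conj_symm, innerProd_zero_left, map_zero]
    set k := P.natDegree
    have hPk : P.degree = k := degree_eq_natDegree h0
    set P' := P - C P.leadingCoeff * rho ν k with hP'
    have hlt : P'.degree < P.degree := by
      refine degree_sub_lt_left ?_ h0 ?_
      · rw [degree_C_mul (leadingCoeff_ne_zero.2 h0), hPk,
          degree_eq_natDegree (rho_monic ν k).ne_zero, natDegree_rho]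
      · rw [leadingCoeff_mul, (rho_monic ν k).leadingCoeff]; simp
    have hsum : P = P' + C P.leadingCoeff * rho ν k := by simp [hP']
    have hkn : k < n := by rw [hPk] at hP; exact_mod_cast hP
    have h1 := ih P'.degree (hd ▸ hlt) (hlt.trans hP) rfl
    rw [hsum, h.innerProd_add_right, h1, innerProd_C_mul_right, h.innerProd_rho_rho_of_lt hkn]
    simp

lemma innerProd_rho_monic (h : ArcMeasure ν a b) {n : ℕ} {P : ℂ[X]} (hP : P.Monic)
    (hn : P.natDegree = n) : innerProd ν (rho ν n) P = innerProd ν (rho ν n) (rho ν n) := by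
  have hPn : P.degree = n := by rw [degree_eq_natDegree hP.ne_zero, hn]
  have hlt : (P - rho ν n).degree < n := by
    rw [← hPn]
    refine degree_sub_lt_left ?_ hP.ne_zero ?_
    · rw [hPn, degree_eq_natDegree (rho_monic ν n).ne_zero, natDegree_rho]
    · rw [hP.leadingCoeff, (rho_monic ν n).leadingCoeff]
  have := h.innerProd_add_right (rho ν n) (P - rho ν n) (rho ν n)
  rwa [h.innerProd_rho_of_natDegree_lt hlt, zero_add, sub_add_cancel] at this

lemma innerProd_eq_zero_of_coeff (h : ArcMeasure ν a b) (P : ℂ[X]) {R : ℂ[X]}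
    (hR : ∀ k, R.coeff k ≠ 0 → innerProd ν P (X ^ k) = 0) : innerProd ν P R = 0 := by
  rw [← innerProd_conj_symm, R.as_sum_support_C_mul_X_pow, h.innerProd_sum_left,
    Finset.sum_eq_zero, map_zero]
  intro k hk
  rw [innerProd_C_mul_left, ← innerProd_conj_symm, hR k (mem_support_iff.1 hk)]
  simp

lemma innerProd_recip_rho_X_pow (h : ArcMeasure ν a b) {n k : ℕ} (hk : 1 ≤ k) (hkn : k ≤ n) :
    innerProd ν (recip n (rho ν n)) (X ^ k) = 0 := by
  rw [h.innerProd_recip_X_pow (natDegree_rho ν n).le hkn, ← innerProd_conj_symm,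
    h.innerProd_rho_of_natDegree_lt, map_zero]
  rw [degree_X_pow]
  exact_mod_cast (by omega : n - k < n)

lemma innerProd_rho_X_pow (h : ArcMeasure ν a b) {n k : ℕ} (hkn : k < n) :
    innerProd ν (rho ν n) (X ^ k) = 0 := by
  refine h.innerProd_rho_of_natDegree_lt ?_
  rw [degree_X_pow]
  exact_mod_cast hkn

/-- If `ρ_n = (z - w) g` with `|w| = 1`, then `z g = ρ_n + w g` with `ρ_n ⟂ g`. Pythagoras gives
`‖g‖² = ‖z g‖² = ‖ρ_n‖² + ‖g‖²`, hence `‖ρ_n‖ = 0`. -/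
lemma rho_eval_ne_zero (h : ArcMeasure ν a b) (n : ℕ) {w : ℂ} (hw : ‖w‖ = 1) :
    (rho ν n).eval w ≠ 0 := by
  intro hroot
  obtain ⟨g, hg⟩ := dvd_iff_isRoot.2 hroot
  have hg0 : g ≠ 0 := by
    rintro rfl
    exact (rho_monic ν n).ne_zero (by simpa using hg)
  have hdeg : g.degree < n := by
    have := natDegree_rho ν n
    rw [hg, natDegree_mul (X_sub_C_ne_zero w) hg0, natDegree_X_sub_C] at this
    rw [degree_eq_natDegree hg0]
    exact_mod_cast (by omega : g.natDegree < n)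
  have hXg : X * g = rho ν n + C w * g := by rw [hg]; ring
  have h1 := h.innerProd_X_mul_X_mul g g
  have h2 : innerProd ν g (rho ν n) = 0 := by
    rw [← innerProd_conj_symm, h.innerProd_rho_of_natDegree_lt hdeg, map_zero]
  rw [hXg, h.innerProd_add_right, h.innerProd_add_left, h.innerProd_add_left,
    innerProd_C_mul_right, innerProd_C_mul_right, innerProd_C_mul_left, innerProd_C_mul_left, h2,
    h.innerProd_rho_of_natDegree_lt hdeg] at h1
  refine h.innerProd_self_ne_zero (rho_monic ν n).ne_zero ?_
  linear_combination h1 - innerProd ν g g * mul_conj_of_norm hw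

lemma recip_rho_eval_ne_zero (h : ArcMeasure ν a b) (n : ℕ) {w : ℂ} (hw : ‖w‖ = 1) :
    (recip n (rho ν n)).eval w ≠ 0 := by
  rw [recip_eval_of_norm (natDegree_rho ν n).le hw]
  exact mul_ne_zero (pow_ne_zero _ (ne_zero_of_norm hw)) (by simpa using h.rho_eval_ne_zero n hw)

lemma norm_blaschke (h : ArcMeasure ν a b) (n : ℕ) {w : ℂ} (hw : ‖w‖ = 1) :
    ‖blaschke ν n w‖ = 1 := by
  unfold blaschke
  rw [recip_eval_of_norm (natDegree_rho ν _).le hw]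
  have := h.rho_eval_ne_zero (n - 1) hw
  simp [hw, this]

end ArcMeasure

/-! ### Cyclic order on the circle -/

/-- Twice the signed area of the triangle `u`, `w`, `v`. -/
def orient (u w v : ℂ) : ℝ := (conj (w - u) * (v - u)).im

lemma orient_rotate (u w v : ℂ) : orient w v u = orient u w v := by
  simp [orient]; ring

lemma orient_swap (u w v : ℂ) : orient v w u = -orient u w v := by
  simp [orient]; ring

lemma orient_swap_right (u w v : ℂ) : orient u v w = -orient u w v := by
  simp [orient]; ring

lemma orient_swap_left (u w v : ℂ) : orient w u v = -orient u w v := by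
  simp [orient]; ring

lemma orient_eq_zero_left (u v : ℂ) : orient u u v = 0 := by simp [orient]

lemma orient_eq_zero_right (u v : ℂ) : orient u v v = 0 := by simp [orient]; ring

lemma orient_mul_exp {a : ℂ} (ha : ‖a‖ = 1) (x y z : ℝ) :
    orient (a * Complex.exp (x * Complex.I)) (a * Complex.exp (y * Complex.I))
      (a * Complex.exp (z * Complex.I)) =
      4 * Real.sin ((y - x) / 2) * Real.sin ((z - y) / 2) * Real.sin ((z - x) / 2) := by
  have h1 : orient (a * Complex.exp (x * Complex.I)) (a * Complex.exp (y * Complex.I))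
      (a * Complex.exp (z * Complex.I)) = Real.sin (z - y) + Real.sin (y - x) - Real.sin (z - x) := by
    unfold orient
    rw [← mul_sub, ← mul_sub, map_mul, show ∀ p q r s : ℂ, p * q * (r * s) = (r * p) * (q * s) by
      intros; ring, mul_conj_of_norm ha, one_mul]
    simp only [map_sub, Complex.mul_im, Complex.sub_re, Complex.sub_im, Complex.conj_re,
      Complex.conj_im, Complex.exp_ofReal_mul_I_re, Complex.exp_ofReal_mul_I_im, Real.sin_sub]
    ring
  rw [h1]
  obtain ⟨p, hp⟩ : ∃ p, p = (y - x) / 2 := ⟨_, rfl⟩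
  obtain ⟨q, hq⟩ : ∃ q, q = (z - y) / 2 := ⟨_, rfl⟩
  rw [← hp, ← hq, show z - y = 2 * q by rw [hq]; ring, show y - x = 2 * p by rw [hp]; ring,
    show (z - x) / 2 = p + q by rw [hp, hq]; ring, show z - x = 2 * p + 2 * q by
      rw [hp, hq]; ring, Real.sin_add, Real.sin_add, Real.cos_two_mul, Real.cos_two_mul,
    Real.sin_two_mul, Real.sin_two_mul]
  have e1 := Real.sin_sq_add_cos_sq p
  have e2 := Real.sin_sq_add_cos_sq q
  linear_combination (-4 * Real.sin q * Real.cos q) * e1 + (-4 * Real.sin p * Real.cos p) * e2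

lemma exists_angle {a z : ℂ} (ha : ‖a‖ = 1) (hz : ‖z‖ = 1) :
    ∃ x : ℝ, 0 ≤ x ∧ x < 2 * Real.pi ∧ z = a * Complex.exp (x * Complex.I) := by
  have ha0 := ne_zero_of_norm ha
  have hmem := toIcoMod_mem_Ico Real.two_pi_pos 0 (z / a).arg
  refine ⟨toIcoMod Real.two_pi_pos 0 (z / a).arg, hmem.1, by simpa using hmem.2, ?_⟩
  have h1 : z / a = Complex.exp ((z / a).arg * Complex.I) := by
    have := Complex.norm_mul_exp_arg_mul_I (z / a)
    rw [norm_div, ha, hz] at this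
    simpa using this.symm
  have h2 : Complex.exp ((toIcoMod Real.two_pi_pos 0 (z / a).arg : ℝ) * Complex.I) =
      Complex.exp ((z / a).arg * Complex.I) := by
    rw [toIcoMod, Complex.exp_eq_exp_iff_exists_int]
    refine ⟨-toIcoDiv Real.two_pi_pos 0 (z / a).arg, ?_⟩
    push_cast [zsmul_eq_mul]
    ring
  rw [h2, ← h1, mul_div_cancel₀ _ ha0]

lemma sin_half_nonneg {x : ℝ} (h0 : 0 ≤ x) (h1 : x ≤ 2 * Real.pi) : 0 ≤ Real.sin (x / 2) :=
  Real.sin_nonneg_of_nonneg_of_le_pi (by linarith) (by linarith)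

lemma sin_half_pos {x : ℝ} (h0 : 0 < x) (h1 : x < 2 * Real.pi) : 0 < Real.sin (x / 2) :=
  Real.sin_pos_of_pos_of_lt_pi (by linarith) (by linarith)

/-- With angles `x`, `y` in `[0, 2π)` measured from `u`, two of the three sine factors of
`orient_mul_exp` are nonnegative, so the sign is decided by `sin ((y - x) / 2)`. -/
lemma mem_openArc_iff {u v w : ℂ} (hu : ‖u‖ = 1) (hv : ‖v‖ = 1) (hw : ‖w‖ = 1) :
    w ∈ openArc u v ↔ 0 < orient u w v := by
  constructor
  · rintro ⟨x, y, hx, hxy, hy, rfl, rfl⟩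
    have := orient_mul_exp hu 0 x y
    simp only [Complex.ofReal_zero, zero_mul, Complex.exp_zero, mul_one, sub_zero] at this
    rw [this]
    have h1 := sin_half_pos hx (hxy.trans hy)
    have h2 := sin_half_pos (sub_pos.2 hxy) (by linarith)
    have h3 := sin_half_pos (hx.trans hxy) hy
    positivity
  · intro h
    obtain ⟨x, hx, hx', hwx⟩ := exists_angle hu hw
    obtain ⟨y, hy, hy', hvy⟩ := exists_angle hu hv
    have := orient_mul_exp hu 0 x y
    simp only [Complex.ofReal_zero, zero_mul, Complex.exp_zero, mul_one, sub_zero] at this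
    rw [← hwx, ← hvy] at this
    rw [this] at h
    have h1 := sin_half_nonneg hx hx'.le
    have h3 := sin_half_nonneg hy hy'.le
    refine ⟨x, y, lt_of_le_of_ne hx ?_, ?_, hy', hwx, hvy⟩
    · rintro rfl
      simp at h
    · by_contra! hc
      have h2 : Real.sin ((y - x) / 2) ≤ 0 := by
        have := sin_half_nonneg (x := x - y) (by linarith) (by linarith)
        rw [show (y - x) / 2 = -((x - y) / 2) by ring, Real.sin_neg]
        linarith
      nlinarith [mul_nonneg h1 h3]

lemma mem_closedArc_iff {a b z : ℂ} (ha : ‖a‖ = 1) (hb : ‖b‖ = 1) :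
    z ∈ closedArc a b ↔ z = a ∨ z = b ∨ z ∈ openArc a b := by
  constructor
  · rintro ⟨x, y, hx, hxy, hy, hz, hb'⟩
    rcases hx.eq_or_lt with rfl | hx
    · left; simpa using hz
    rcases hxy.eq_or_lt with rfl | hxy
    · right; left; rw [hz, hb']
    · right; right; exact ⟨x, y, hx, hxy, hy, hz, hb'⟩
  · rintro (rfl | rfl | ⟨x, y, hx, hxy, hy, hz, hb'⟩)
    · obtain ⟨y, hy, hy', h⟩ := exists_angle ha hb
      exact ⟨0, y, le_rfl, hy, hy', by simp, h⟩
    · obtain ⟨y, hy, hy', h⟩ := exists_angle ha hb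
      exact ⟨y, y, hy, le_rfl, hy', h, h⟩
    · exact ⟨x, y, hx.le, hxy.le, hy, hz, hb'⟩

lemma left_notMem_openArc {a b : ℂ} (ha : ‖a‖ = 1) (hb : ‖b‖ = 1) : a ∉ openArc a b := by
  rw [mem_openArc_iff ha hb ha, orient_eq_zero_left]; simp

lemma right_notMem_openArc {a b : ℂ} (ha : ‖a‖ = 1) (hb : ‖b‖ = 1) : b ∉ openArc a b := by
  rw [mem_openArc_iff ha hb hb, orient_eq_zero_right]; simp

/-- An arc lies on one side of any chord joining two points of the complementary arc. -/
lemma orient_nonneg_or_nonpos {a b w₁ w₂ : ℂ} (ha : ‖a‖ = 1)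
    (hw₁ : ‖w₁‖ = 1) (hw₂ : ‖w₂‖ = 1) (h₁ : w₁ ∉ openArc a b) (h₂ : w₂ ∉ openArc a b) :
    (∀ z ∈ closedArc a b, 0 ≤ orient w₁ z w₂) ∨ (∀ z ∈ closedArc a b, orient w₁ z w₂ ≤ 0) := by
  have key : ∀ w, ‖w‖ = 1 → w ∉ openArc a b → ∃ x : ℝ, x ≤ 2 * Real.pi ∧
      w = a * Complex.exp (x * Complex.I) ∧ ∀ y, 0 ≤ y → y < 2 * Real.pi →
        b = a * Complex.exp (y * Complex.I) → y ≤ x := by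
    intro w hw hwn
    obtain ⟨x, hx, hx', hwx⟩ := exists_angle ha hw
    -- The point `a` itself gets the angle `2π` instead of `0`, so that every point off the open arc
    -- has an angle at least that of `b`.
    rcases hx.eq_or_lt with rfl | hx
    · refine ⟨2 * Real.pi, le_rfl, ?_, fun y _ hy _ => hy.le⟩
      rw [hwx]
      push_cast
      rw [Complex.exp_two_pi_mul_I]; simp
    · refine ⟨x, hx'.le, hwx, fun y hy hy' hby => ?_⟩
      by_contra! hc
      exact hwn ⟨x, y, hx, hc, hy', hwx, hby⟩
  have main : ∀ x₁ x₂ : ℝ, x₁ ≤ x₂ → x₂ ≤ 2 * Real.pi → (∀ y, 0 ≤ y → y < 2 * Real.pi →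
        b = a * Complex.exp (y * Complex.I) → y ≤ x₁) → ∀ z ∈ closedArc a b,
        orient (a * Complex.exp (x₁ * Complex.I)) z (a * Complex.exp (x₂ * Complex.I)) ≤ 0 := by
    rintro x₁ x₂ h12 h2 hy₁ z ⟨t, y, ht, hty, hy, rfl, hb⟩
    have := hy₁ y (ht.trans hty) hy hb
    rw [orient_mul_exp ha]
    have s1 := sin_half_nonneg (x := x₁ - t) (by linarith) (by linarith)
    have s2 := sin_half_nonneg (x := x₂ - t) (by linarith) (by linarith)
    have s3 := sin_half_nonneg (x := x₂ - x₁) (by linarith) (by linarith)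
    rw [show (t - x₁) / 2 = -((x₁ - t) / 2) by ring, Real.sin_neg]
    nlinarith [mul_nonneg (mul_nonneg s1 s2) s3]
  obtain ⟨x₁, hx₁, rfl, hy₁⟩ := key w₁ hw₁ h₁
  obtain ⟨x₂, hx₂, rfl, hy₂⟩ := key w₂ hw₂ h₂
  rcases le_total x₁ x₂ with h | h
  · exact Or.inr (main x₁ x₂ h hx₂ hy₁)
  · refine Or.inl fun z hz => ?_
    rw [orient_swap]
    linarith [main x₂ x₁ h hx₁ hy₂ z hz]

/-- The bridge from geometry to inner products: the right side has the shape of the integrand of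
`⟨(z - u)(z - v) g, z g⟩`, whose phase is thus constant wherever `orient` keeps its sign. -/
lemma two_I_mul_orient {u v w : ℂ} (hu : ‖u‖ = 1) (hv : ‖v‖ = 1) (hw : ‖w‖ = 1) :
    2 * Complex.I * orient u w v = (w - u) * (w - v) * conj w * conj (u - v) := by
  have h := Complex.sub_conj (conj (w - u) * (v - u))
  have hu0 := ne_zero_of_norm hu
  have hv0 := ne_zero_of_norm hv
  have hw0 := ne_zero_of_norm hw
  rw [orient, mul_right_comm, ← Complex.ofReal_ofNat, ← Complex.ofReal_mul, ← h]
  simp only [map_mul, map_sub, Complex.conj_conj]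
  simp only [conj_eq_inv_of_norm hu, conj_eq_inv_of_norm hv, conj_eq_inv_of_norm hw]
  field_simp
  ring

/-- The imaginary part of `z / (z - w)`: up to a factor, the cotangent of half the angle from `w`
to `z`. -/
def halfCot (w z : ℂ) : ℝ := (z / (z - w)).im

lemma halfCot_sub {u v w : ℂ} (hu : ‖u‖ = 1) (hv : ‖v‖ = 1) (hw : ‖w‖ = 1) (huw : u ≠ w)
    (hvw : v ≠ w) : (halfCot w u - halfCot w v) * (Complex.normSq (u - w) * Complex.normSq (v - w)) =
      2 * orient u w v := by
  have hu0 := ne_zero_of_norm hu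
  have hv0 := ne_zero_of_norm hv
  have hw0 := ne_zero_of_norm hw
  have huw' := sub_ne_zero.2 huw
  have hvw' := sub_ne_zero.2 hvw
  have h1 : (u / (u - w) - v / (v - w)) *
      ((Complex.normSq (u - w) * Complex.normSq (v - w) : ℝ) : ℂ) =
      2 * Complex.I * orient u w v := by
    rw [two_I_mul_orient hu hv hw]
    push_cast
    rw [← Complex.mul_conj, ← Complex.mul_conj]
    simp only [map_sub, conj_eq_inv_of_norm hu, conj_eq_inv_of_norm hv,
      conj_eq_inv_of_norm hw]
    field_simp
    ring
  have h2 := congrArg Complex.im h1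
  rw [Complex.im_mul_ofReal, Complex.sub_im] at h2
  rw [halfCot, halfCot, h2]
  simp

/-- If `θ` is the angle from `w` to `z`, then `halfCot w z = -cot (θ / 2) / 2`, which increases as
`z` runs counterclockwise around the circle from `w`. -/
lemma halfCot_lt_iff {u v w : ℂ} (hu : ‖u‖ = 1) (hv : ‖v‖ = 1) (hw : ‖w‖ = 1) (huw : u ≠ w)
    (hvw : v ≠ w) : halfCot w v < halfCot w u ↔ 0 < orient u w v := by
  have h := halfCot_sub hu hv hw huw hvw
  have hp : 0 < Complex.normSq (u - w) * Complex.normSq (v - w) :=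
    mul_pos (Complex.normSq_pos.2 (sub_ne_zero.2 huw)) (Complex.normSq_pos.2 (sub_ne_zero.2 hvw))
  rw [← sub_pos, ← mul_pos_iff_of_pos_right hp, h]
  constructor <;> intro <;> linarith

lemma orient_ne_zero {u v w : ℂ} (hu : ‖u‖ = 1) (hv : ‖v‖ = 1) (hw : ‖w‖ = 1) (huw : u ≠ w)
    (hvw : v ≠ w) (huv : u ≠ v) : orient u w v ≠ 0 := by
  intro h
  have := two_I_mul_orient hu hv hw
  rw [h] at this
  simp [sub_eq_zero, huw.symm, hvw.symm, ne_zero_of_norm hw, (starRingEnd ℂ).injective.eq_iff, huv] at this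

/-- Cutting the circle at `b` turns cyclic order into the linear order of `halfCot b`. There `ζ`
precedes `a` and `a` precedes `w`, so transitivity applies. -/
lemma orient_neg_of_pos_of_neg {a b w ζ : ℂ} (ha : ‖a‖ = 1) (hb : ‖b‖ = 1) (hw : ‖w‖ = 1)
    (hζ : ‖ζ‖ = 1) (h₁ : 0 < orient a w b) (h₂ : orient a ζ b < 0) : orient w ζ b < 0 := by
  have hab : a ≠ b := by rintro rfl; simp [orient] at h₁
  have hwb : w ≠ b := by rintro rfl; simp [orient_eq_zero_right] at h₁
  have hζb : ζ ≠ b := by rintro rfl; simp [orient_eq_zero_right] at h₂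
  have e1 : halfCot b a < halfCot b w := by
    rw [halfCot_lt_iff hw ha hb hwb hab, orient_rotate]; exact h₁
  have e2 : halfCot b ζ < halfCot b a := by
    rw [halfCot_lt_iff ha hζ hb hab hζb, orient_swap_right]; linarith
  have e3 := (halfCot_lt_iff hw hζ hb hwb hζb).1 (e2.trans e1)
  rw [orient_swap_right] at e3
  linarith

/-! ### Zeros of paraorthogonal polynomials -/

/-- The paraorthogonal polynomial `z ρ_m(z) - c ρ_m^*(z)`. -/
def popuc (ν : Measure ℂ) (m : ℕ) (c : ℂ) : ℂ[X] :=
  X * rho ν m - C c * recip m (rho ν m)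

lemma natDegree_C_mul_recip_rho_le (ν : Measure ℂ) (m : ℕ) (c : ℂ) :
    (C c * recip m (rho ν m)).natDegree ≤ m :=
  (natDegree_C_mul_le _ _).trans (natDegree_recip_le (natDegree_rho ν m).le)

lemma natDegree_X_mul_rho (ν : Measure ℂ) (m : ℕ) : (X * rho ν m).natDegree = m + 1 := by
  rw [natDegree_X_mul (rho_monic ν m).ne_zero, natDegree_rho]

lemma natDegree_popuc (ν : Measure ℂ) (m : ℕ) (c : ℂ) : (popuc ν m c).natDegree = m + 1 := by
  unfold popuc
  rw [natDegree_sub_eq_left_of_natDegree_lt, natDegree_X_mul_rho]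
  rw [natDegree_X_mul_rho]
  exact Nat.lt_succ_of_le (natDegree_C_mul_recip_rho_le ν m c)

lemma popuc_monic (ν : Measure ℂ) (m : ℕ) (c : ℂ) : (popuc ν m c).Monic := by
  refine (monic_X.mul (rho_monic ν m)).sub_of_left ?_
  refine degree_lt_degree ?_
  rw [natDegree_X_mul_rho]
  exact Nat.lt_succ_of_le (natDegree_C_mul_recip_rho_le ν m c)

lemma recip_one_one : recip 1 1 = X := by
  rw [← recip_X, recip_recip]

lemma popuc_eq_recip (ν : Measure ℂ) (m : ℕ) {c : ℂ} (hc : ‖c‖ = 1) :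
    popuc ν m c = C (-c) * recip (1 + m) (popuc ν m c) := by
  have h1 : recip (1 + m) (X * rho ν m) = recip m (rho ν m) := by
    rw [recip_mul natDegree_X_le (natDegree_rho ν m).le, recip_X, one_mul]
  have h2 : recip (1 + m) (recip m (rho ν m)) = X * rho ν m := by
    have := recip_mul (m := 1) (n := m) (P := 1) (R := recip m (rho ν m)) (by simp)
      (natDegree_recip_le (natDegree_rho ν m).le)
    rwa [recip_recip, recip_one_one, one_mul] at this
  have h3 : popuc ν m c = X * rho ν m + C (-c) * recip m (rho ν m) := by
    rw [popuc, C_neg]; ring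
  have h4 : C (-c) * C (conj (-c)) = 1 := by
    rw [← C_mul, mul_conj_of_norm (by simpa using hc), C_1]
  conv_rhs => rw [h3, recip_add, recip_C_mul, h1, h2]
  rw [h3]
  linear_combination (-X * rho ν m) * h4

lemma popuc_coeff_zero (ν : Measure ℂ) (m : ℕ) (c : ℂ) : (popuc ν m c).coeff 0 = -c := by
  have := rho_monic ν m
  rw [Monic, leadingCoeff, natDegree_rho] at this
  simp [popuc, mul_coeff_zero, recip_coeff_zero, this]

lemma exists_factor_of_two_roots {P : ℂ[X]} {w₁ w₂ : ℂ} (h₁ : P.IsRoot w₁) (h₂ : P.IsRoot w₂)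
    (hne : w₁ ≠ w₂) : ∃ g, P = (X - C w₁) * (X - C w₂) * g :=
  (pairwise_coprime_X_sub_C (K := ℂ) Function.injective_id hne).mul_dvd
    (dvd_iff_isRoot.2 h₁) (dvd_iff_isRoot.2 h₂)

namespace ArcMeasure

variable {ν : Measure ℂ} {a b : ℂ} [IsFiniteMeasure ν]

/-- An arc polynomial with two zeros `w₁`, `w₂` outside the arc is not orthogonal to `z g`, where
`g` is the remaining factor. -/
lemma innerProd_two_roots_ne_zero (h : ArcMeasure ν a b) {w₁ w₂ : ℂ} (hw₁ : ‖w₁‖ = 1)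
    (hw₂ : ‖w₂‖ = 1) (hne : w₁ ≠ w₂) (h₁ : w₁ ∉ openArc a b) (h₂ : w₂ ∉ openArc a b) {g : ℂ[X]}
    (hg : g ≠ 0) : innerProd ν ((X - C w₁) * (X - C w₂) * g) (X * g) ≠ 0 := by
  intro h0
  have hcont : Continuous fun z : ℂ => orient w₁ z w₂ * Complex.normSq (g.eval z) := by
    unfold orient
    have := g.continuous
    fun_prop
  have hzero : ∀ z ∈ closedArc a b, orient w₁ z w₂ * Complex.normSq (g.eval z) = 0 →
      z ∈ {z | ((X - C w₁) * (X - C w₂) * g).IsRoot z} := by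
    intro z hz hz0
    have hz1 := norm_of_mem_closedArc h.norm_left hz
    simp only [Set.mem_ofPred_eq, IsRoot.def, eval_mul, eval_sub, eval_X, eval_C, mul_eq_zero,
      sub_eq_zero]
    rcases mul_eq_zero.1 hz0 with hz0 | hz0
    · left
      by_contra! hc
      exact orient_ne_zero hw₁ hw₂ hz1 hc.1.symm hc.2.symm hne hz0
    · right; simpa using hz0
  have hfin : {z | ((X - C w₁) * (X - C w₂) * g).IsRoot z}.Finite :=
    finite_setOfPred_isRoot (mul_ne_zero (mul_ne_zero (X_sub_C_ne_zero _) (X_sub_C_ne_zero _)) hg)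
  -- Up to a constant factor, the inner product is the integral of `|g|²` against the real weight
  -- `orient w₁ z w₂`.
  have hint : ∫ z, ((orient w₁ z w₂ * Complex.normSq (g.eval z) : ℝ) : ℂ) ∂ν = 0 := by
    have : ∫ z, ((orient w₁ z w₂ * Complex.normSq (g.eval z) : ℝ) : ℂ) ∂ν =
        (conj (w₁ - w₂) / (2 * Complex.I)) *
          innerProd ν ((X - C w₁) * (X - C w₂) * g) (X * g) := by
      unfold innerProd
      rw [← integral_const_mul]
      refine integral_congr_ae (h.ae_norm.mono fun z hz => ?_)
      have e := two_I_mul_orient hw₁ hw₂ hz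
      have hI : (2 * Complex.I) ≠ 0 := by simp
      simp only [eval_mul, eval_sub, eval_X, eval_C, map_mul]
      rw [div_mul_eq_mul_div, eq_div_iff hI]
      push_cast
      rw [← Complex.mul_conj]
      linear_combination (eval z g * conj (eval z g)) * e
    rw [this, h0, mul_zero]
  rcases orient_nonneg_or_nonpos h.norm_left hw₁ hw₂ h₁ h₂ with hs | hs
  · refine h.integral_ne_zero (f := fun z => ((orient w₁ z w₂ * Complex.normSq (g.eval z) : ℝ) : ℂ))
      (Complex.continuous_ofReal.comp hcont) (fun z hz => ?_) hfin
      (fun z hz hz0 => hzero z hz (by exact_mod_cast hz0)) hint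
    have := mul_nonneg (hs z hz) (Complex.normSq_nonneg (g.eval z))
    exact_mod_cast this
  · refine h.integral_ne_zero (f := fun z => ((-(orient w₁ z w₂ * Complex.normSq (g.eval z)) : ℝ) : ℂ))
      (Complex.continuous_ofReal.comp hcont.neg) (fun z hz => ?_) hfin
      (fun z hz hz0 => hzero z hz (neg_eq_zero.1 (by exact_mod_cast hz0))) ?_
    · have := mul_nonneg (neg_nonneg.2 (hs z hz)) (Complex.normSq_nonneg (g.eval z))
      rw [neg_mul] at this
      exact_mod_cast this
    · simp only [Complex.ofReal_neg]
      rw [integral_neg, hint, neg_zero]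

/-- On the circle `(z - w)(1 - conj w z) conj z = |z - w|²`. This excludes zeros off the circle,
which come in reflected pairs, and double zeros on it, where the pair coincides. -/
lemma innerProd_reflected_roots_ne_zero (h : ArcMeasure ν a b) (w : ℂ) {g : ℂ[X]} (hg : g ≠ 0) :
    innerProd ν ((X - C w) * (1 - C (conj w) * X) * g) (X * g) ≠ 0 := by
  have : innerProd ν ((X - C w) * (1 - C (conj w) * X) * g) (X * g) =
      innerProd ν ((X - C w) * g) ((X - C w) * g) := by
    refine integral_congr_ae (h.ae_norm.mono fun z hz => ?_)
    simp only [eval_mul, eval_sub, eval_X, eval_C, map_mul, map_sub, eval_one]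
    linear_combination (-conj w) * ((z - w) * eval z g * conj (eval z g)) * mul_conj_of_norm hz
  rw [this]
  exact h.innerProd_self_ne_zero (mul_ne_zero (X_sub_C_ne_zero w) hg)

/-- Both `z ρ_m` and `ρ_m^*` are orthogonal to `z, …, z^m`. -/
lemma innerProd_popuc_eq_zero (h : ArcMeasure ν a b) {m : ℕ} (c : ℂ) {S : ℂ[X]}
    (hS : S.natDegree ≤ m) (hS0 : S.coeff 0 = 0) : innerProd ν (popuc ν m c) S = 0 := by
  refine h.innerProd_eq_zero_of_coeff _ fun k hk => ?_
  have hk0 : k ≠ 0 := by rintro rfl; exact hk hS0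
  have hkm : k ≤ m := (le_natDegree_of_ne_zero hk).trans hS
  obtain ⟨j, rfl⟩ := Nat.exists_eq_succ_of_ne_zero hk0
  rw [popuc, h.innerProd_sub_left, innerProd_C_mul_left,
    h.innerProd_recip_rho_X_pow (by omega) hkm, Nat.succ_eq_add_one, pow_succ', h.innerProd_X_mul_X_mul,
    h.innerProd_rho_X_pow (by omega)]
  simp

lemma innerProd_popuc_factor_eq_zero (h : ArcMeasure ν a b) {m : ℕ} {c : ℂ} {w₁ w₂ : ℂ} {g : ℂ[X]}
    (hg : popuc ν m c = (X - C w₁) * (X - C w₂) * g) :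
    g ≠ 0 ∧ innerProd ν ((X - C w₁) * (X - C w₂) * g) (X * g) = 0 := by
  have hg0 : g ≠ 0 := by
    rintro rfl
    exact (popuc_monic ν m c).ne_zero (by simpa using hg)
  refine ⟨hg0, ?_⟩
  rw [← hg]
  refine h.innerProd_popuc_eq_zero c ?_ (by simp)
  have := natDegree_popuc ν m c
  rw [hg, natDegree_mul (mul_ne_zero (X_sub_C_ne_zero _) (X_sub_C_ne_zero _)) hg0,
    natDegree_mul (X_sub_C_ne_zero _) (X_sub_C_ne_zero _), natDegree_X_sub_C,
    natDegree_X_sub_C] at this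
  rw [natDegree_X_mul hg0]
  omega

lemma norm_of_popuc_isRoot (h : ArcMeasure ν a b) {m : ℕ} {c : ℂ} (hc : ‖c‖ = 1) {w : ℂ}
    (hw : (popuc ν m c).IsRoot w) : ‖w‖ = 1 := by
  have hw0 : w ≠ 0 := by
    rintro rfl
    rw [IsRoot.def, ← coeff_zero_eq_eval_zero, popuc_coeff_zero, neg_eq_zero] at hw
    exact ne_zero_of_norm hc hw
  have hcw : conj w ≠ 0 := by simpa using hw0
  by_contra hn
  have hne : w ≠ (conj w)⁻¹ := by
    intro he
    apply hn
    have h1 : w * conj w = 1 := by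
      nth_rewrite 1 [he]
      exact inv_mul_cancel₀ hcw
    rw [Complex.mul_conj, Complex.normSq_eq_norm_sq] at h1
    have h2 : ‖w‖ ^ 2 = 1 := by exact_mod_cast h1
    exact (pow_eq_one_iff_of_nonneg (norm_nonneg w) two_ne_zero).1 h2
  -- Invariance under the reciprocal map makes the zero set symmetric in the circle.
  have hroot : (popuc ν m c).IsRoot (conj w)⁻¹ := by
    have h1 := hw
    rw [popuc_eq_recip ν m hc, IsRoot.def, eval_mul, eval_C,
      recip_eval (by rw [natDegree_popuc, add_comm]) hw0] at h1
    simpa [ne_zero_of_norm hc, hw0] using h1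
  obtain ⟨g, hg⟩ := exists_factor_of_two_roots hw hroot hne
  obtain ⟨hg0, h0⟩ := h.innerProd_popuc_factor_eq_zero hg
  refine h.innerProd_reflected_roots_ne_zero w hg0 ?_
  have : (X - C w) * (1 - C (conj w) * X) * g =
      C (-conj w) * ((X - C w) * (X - C (conj w)⁻¹) * g) := by
    have e : C (conj w) * C (conj w)⁻¹ = 1 := by rw [← C_mul, mul_inv_cancel₀ hcw, C_1]
    rw [C_neg]
    linear_combination (-(X - C w) * g) * e
  rw [this, innerProd_C_mul_left, h0, mul_zero]

lemma nodup_roots_popuc (h : ArcMeasure ν a b) {m : ℕ} {c : ℂ} (hc : ‖c‖ = 1) :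
    (popuc ν m c).roots.Nodup := by
  rw [Multiset.nodup_iff_count_le_one]
  intro w
  by_contra! hlt
  rw [count_roots] at hlt
  have hw : (popuc ν m c).IsRoot w :=
    (rootMultiplicity_pos (popuc_monic ν m c).ne_zero).1 (by omega)
  have hw1 := h.norm_of_popuc_isRoot hc hw
  obtain ⟨g, hg⟩ := (le_rootMultiplicity_iff (popuc_monic ν m c).ne_zero).1 hlt
  rw [pow_succ, pow_one] at hg
  obtain ⟨hg0, h0⟩ := h.innerProd_popuc_factor_eq_zero hg
  refine h.innerProd_reflected_roots_ne_zero w hg0 ?_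
  have : (X - C w) * (1 - C (conj w) * X) * g =
      C (-conj w) * ((X - C w) * (X - C w) * g) := by
    have e : C w * C (conj w) = 1 := by rw [← C_mul, mul_conj_of_norm hw1, C_1]
    rw [C_neg]
    linear_combination (-(X - C w) * g) * e
  rw [this, innerProd_C_mul_left, h0, mul_zero]

lemma popuc_roots_outside_unique (h : ArcMeasure ν a b) {m : ℕ} {c : ℂ} (hc : ‖c‖ = 1) {w₁ w₂ : ℂ}
    (h₁ : (popuc ν m c).IsRoot w₁) (h₂ : (popuc ν m c).IsRoot w₂) (hw₁ : w₁ ∉ openArc a b)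
    (hw₂ : w₂ ∉ openArc a b) : w₁ = w₂ := by
  by_contra hne
  obtain ⟨g, hg⟩ := exists_factor_of_two_roots h₁ h₂ hne
  obtain ⟨hg0, h0⟩ := h.innerProd_popuc_factor_eq_zero hg
  exact h.innerProd_two_roots_ne_zero (h.norm_of_popuc_isRoot hc h₁) (h.norm_of_popuc_isRoot hc h₂)
    hne hw₁ hw₂ hg0 h0

lemma popuc_isRoot_iff (h : ArcMeasure ν a b) {m : ℕ} {c z : ℂ} (hz : ‖z‖ = 1) :
    (popuc ν m c).IsRoot z ↔ blaschke ν (m + 1) z = c := by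
  have := h.recip_rho_eval_ne_zero m hz
  rw [blaschke, Nat.add_sub_cancel, div_eq_iff this, IsRoot.def, popuc]
  simp [sub_eq_zero]

/-! ### Positive partial fractions and the location of all zeros -/

/-- Positivity of the quadrature weights. -/
lemma rho_eval_div_pos (h : ArcMeasure ν a b) {m : ℕ} {c : ℂ} {ζ : ℂ} (hζ : ‖ζ‖ = 1) {g : ℂ[X]}
    (hg : popuc ν m c = (X - C ζ) * g) : 0 < (rho ν m).eval ζ / g.eval ζ := by
  have hgm : g.Monic := (monic_X_sub_C ζ).of_mul_monic_left (hg ▸ popuc_monic ν m c)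
  have hgd : g.natDegree = m := by
    have := natDegree_popuc ν m c
    rw [hg, natDegree_mul (X_sub_C_ne_zero ζ) hgm.ne_zero, natDegree_X_sub_C] at this
    omega
  -- Up to a scalar, `g` is the reproducing kernel at `ζ` in degree at most `m`: on the circle `conj
  -- (z - ζ) = -conj ζ (z - ζ) conj z`, so `⟨g, (z - ζ) q⟩` is a multiple of `⟨popuc, z q⟩ = 0`.
  -- Taking `P = g` and `P = ρ_m` exhibits the conjugate of the required ratio as a quotient of
  -- squared norms.
  have rep : ∀ P : ℂ[X], P.natDegree ≤ m →
      innerProd ν g P = conj (P.eval ζ) * innerProd ν g 1 := by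
    intro P hP
    obtain ⟨q, hq⟩ := X_sub_C_dvd_sub_C_eval (a := ζ) (p := P)
    have hP' : P = C (P.eval ζ) * 1 + (X - C ζ) * q := by rw [← hq]; ring
    have h1 : innerProd ν g ((X - C ζ) * q) = -conj ζ * innerProd ν (popuc ν m c) (X * q) := by
      rw [hg]
      unfold innerProd
      rw [← integral_const_mul]
      refine integral_congr_ae (h.ae_norm.mono fun z hz => ?_)
      simp only [eval_mul, eval_sub, eval_X, eval_C, map_mul, map_sub]
      linear_combination (conj ζ * eval z g * conj (eval z q)) * mul_conj_of_norm hz -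
        (conj z * eval z g * conj (eval z q)) * mul_conj_of_norm hζ
    have hdeg : (X * q).natDegree ≤ m := by
      by_cases hq0 : q = 0
      · simp [hq0]
      have h2 : ((X - C ζ) * q).natDegree ≤ m := by
        rw [← hq]
        exact (natDegree_sub_C (a := eval ζ P)).le.trans hP
      rw [natDegree_mul (X_sub_C_ne_zero ζ) hq0, natDegree_X_sub_C] at h2
      rw [natDegree_X_mul hq0]
      omega
    nth_rewrite 1 [hP']
    rw [h.innerProd_add_right, innerProd_C_mul_right, h1,
      h.innerProd_popuc_eq_zero c hdeg (by simp)]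
    ring
  have e1 := rep g hgd.le
  have e2 := rep (rho ν m) (natDegree_rho ν m).le
  rw [← innerProd_conj_symm, h.innerProd_rho_monic hgm hgd, innerProd_conj_symm] at e2
  have p1 := h.innerProd_self_pos hgm.ne_zero
  have p2 := h.innerProd_self_pos (rho_monic ν m).ne_zero
  have p3 := div_pos p2 p1
  have ht : innerProd ν g 1 ≠ 0 := by
    intro h0
    rw [h0, mul_zero] at e1
    exact p1.ne' e1
  have e3 : conj ((rho ν m).eval ζ / g.eval ζ) =
      innerProd ν (rho ν m) (rho ν m) / innerProd ν g g := by
    rw [e1, e2, map_div₀, mul_div_mul_right _ _ ht]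
  rw [← e3] at p3
  have := star_pos_iff.2 p3
  rwa [show star (conj ((rho ν m).eval ζ / g.eval ζ)) = (rho ν m).eval ζ / g.eval ζ from
    Complex.conj_conj _] at this

lemma exists_quadrature (h : ArcMeasure ν a b) (m : ℕ) {c : ℂ} (hc : ‖c‖ = 1) :
    ∃ w : ℂ → ℝ, (∀ ζ ∈ (popuc ν m c).roots.toFinset, 0 < w ζ) ∧
      ∀ z, ‖z‖ = 1 → ¬ (popuc ν m c).IsRoot z → halfCot c (blaschke ν (m + 1) z) =
        ∑ ζ ∈ (popuc ν m c).roots.toFinset, w ζ * halfCot ζ z := by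
  classical
  set R := popuc ν m c with hR
  set Z := R.roots.toFinset with hZ
  have hR0 : R ≠ 0 := (popuc_monic ν m c).ne_zero
  have hsplit : R.Splits := IsAlgClosed.splits R
  have hval : Z.val = R.roots := by
    rw [hZ, Multiset.toFinset_val, (h.nodup_roots_popuc hc).dedup]
  have hnodal : R = Lagrange.nodal Z id := by
    have := hsplit.eq_prod_roots_of_monic (popuc_monic ν m c)
    rw [this, Lagrange.nodal, Finset.prod, hval]
    rfl
  have hcard : Z.card = m + 1 := by
    rw [Finset.card, hval, ← hsplit.natDegree_eq_card_roots, natDegree_popuc]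
  have hmem : ∀ ζ, ζ ∈ Z ↔ R.IsRoot ζ := fun ζ => by
    rw [hZ, Multiset.mem_toFinset, mem_roots hR0]
  have hpos : ∀ ζ ∈ Z, 0 < Lagrange.nodalWeight Z id ζ * (rho ν m).eval ζ := by
    intro ζ hζ
    have hζ1 := h.norm_of_popuc_isRoot hc ((hmem ζ).1 hζ)
    have := h.rho_eval_div_pos (m := m) (c := c) hζ1 (g := Lagrange.nodal (Z.erase ζ) id) (by
      rw [← hR, hnodal, Lagrange.nodal_eq_mul_nodal_erase hζ]; rfl)
    rw [Lagrange.nodalWeight_eq_eval_nodal_erase_inv]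
    rwa [div_eq_inv_mul] at this
  refine ⟨fun ζ => (Lagrange.nodalWeight Z id ζ * (rho ν m).eval ζ).re,
    fun ζ hζ => (Complex.pos_iff.1 (hpos ζ hζ)).1, fun z hz hzR => ?_⟩
  have hzZ : ∀ ζ ∈ Z, z ≠ id ζ := by
    rintro ζ hζ rfl
    exact hzR ((hmem _).1 hζ)
  -- Lagrange interpolation of `ρ_m`, of degree `m`, at the `m + 1` zeros of `R`.
  have e1 : (rho ν m).eval z = R.eval z *
      ∑ ζ ∈ Z, Lagrange.nodalWeight Z id ζ * (z - ζ)⁻¹ * (rho ν m).eval ζ := by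
    have := Lagrange.eq_interpolate (s := Z) (v := id) (f := rho ν m) Function.injective_id.injOn (by
      rw [degree_eq_natDegree (rho_monic ν m).ne_zero, natDegree_rho, hcard]
      exact_mod_cast Nat.lt_succ_self m)
    nth_rewrite 1 [this]
    rw [Lagrange.eval_interpolate_not_at_node _ hzZ, ← hnodal]
    rfl
  have hs := h.recip_rho_eval_ne_zero m hz
  have hRz : R.eval z ≠ 0 := hzR
  have e2 : blaschke ν (m + 1) z / (blaschke ν (m + 1) z - c) =
      ∑ ζ ∈ Z, (Lagrange.nodalWeight Z id ζ * (rho ν m).eval ζ) * (z / (z - ζ)) := by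
    have e3 : blaschke ν (m + 1) z / (blaschke ν (m + 1) z - c) =
        z * (rho ν m).eval z / R.eval z := by
      have e4 : R.eval z = z * (rho ν m).eval z - c * (recip m (rho ν m)).eval z := by
        simp [hR, popuc]
      rw [blaschke, Nat.add_sub_cancel, div_sub' hs, div_div_div_cancel_right₀ hs, e4,
        mul_comm c]
    rw [e3, e1, mul_left_comm, mul_div_cancel_left₀ _ hRz, Finset.mul_sum]
    refine Finset.sum_congr rfl fun ζ _ => ?_
    rw [div_eq_mul_inv]; ring
  rw [halfCot, e2, Complex.im_sum]
  refine Finset.sum_congr rfl fun ζ hζ => ?_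
  have him := (Complex.pos_iff.1 (hpos ζ hζ)).2
  simp only [halfCot]
  rw [Complex.mul_im, ← him]
  simp

/-- All zeros of a paraorthogonal polynomial lie in the open arc iff its parameter lies between the
boundary values of the Blaschke product. -/
theorem popuc_roots_mem_openArc_iff (h : ArcMeasure ν a b) (m : ℕ) {c : ℂ} (hc : ‖c‖ = 1) :
    (∀ z, (popuc ν m c).IsRoot z → z ∈ openArc a b) ↔
      c ∈ openArc (blaschke ν (m + 1) a) (blaschke ν (m + 1) b) := by
  have ha := h.norm_left
  have hb := h.norm_right
  have hFa := h.norm_blaschke (m + 1) ha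
  have hFb := h.norm_blaschke (m + 1) hb
  have haO := left_notMem_openArc ha hb
  have hbO := right_notMem_openArc ha hb
  have hnonempty : ∀ c, (popuc ν m c).roots.toFinset.Nonempty := by
    intro c
    obtain ⟨z, hz⟩ := IsAlgClosed.exists_root (popuc ν m c) (by
      rw [degree_eq_natDegree (popuc_monic ν m c).ne_zero, natDegree_popuc]
      exact_mod_cast Nat.succ_ne_zero m)
    exact ⟨z, by rw [Multiset.mem_toFinset, mem_roots (popuc_monic ν m c).ne_zero]; exact hz⟩
  have hmem : ∀ c z, z ∈ (popuc ν m c).roots.toFinset → (popuc ν m c).IsRoot z := by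
    intro c z hz
    rwa [Multiset.mem_toFinset, mem_roots (popuc_monic ν m c).ne_zero] at hz
  rw [mem_openArc_iff hFa hFb hc]
  constructor
  · intro hall
    have hna : ¬ (popuc ν m c).IsRoot a := fun hr => haO (hall a hr)
    have hnb : ¬ (popuc ν m c).IsRoot b := fun hr => hbO (hall b hr)
    obtain ⟨w, hw, hquad⟩ := h.exists_quadrature m hc
    rw [← halfCot_lt_iff hFa hFb hc (fun he => hna ((h.popuc_isRoot_iff ha).2 he))
      (fun he => hnb ((h.popuc_isRoot_iff hb).2 he)), hquad a ha hna, hquad b hb hnb]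
    refine Finset.sum_lt_sum_of_nonempty (hnonempty c) fun ζ hζ => ?_
    have hr := hmem c ζ hζ
    have hζ1 := h.norm_of_popuc_isRoot hc hr
    refine mul_lt_mul_of_pos_left ?_ (hw ζ hζ)
    rw [halfCot_lt_iff ha hb hζ1 (by rintro rfl; exact hna hr) (by rintro rfl; exact hnb hr),
      ← mem_openArc_iff ha hb hζ1]
    exact hall ζ hr
  · intro hpos z hz
    by_contra hzO
    have hz1 := h.norm_of_popuc_isRoot hc hz
    have hFz := (h.popuc_isRoot_iff hz1).1 hz
    have hza : z ≠ a := by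
      rintro rfl
      rw [hFz, orient_eq_zero_left] at hpos
      exact hpos.false
    have hzb : z ≠ b := by
      rintro rfl
      rw [hFz, orient_eq_zero_right] at hpos
      exact hpos.false
    have hzneg : orient a z b < 0 := by
      refine lt_of_le_of_ne ?_ (orient_ne_zero ha hb hz1 hza.symm hzb.symm h.ne)
      rw [mem_openArc_iff ha hb hz1] at hzO
      exact not_lt.1 hzO
    -- Compare with the paraorthogonal polynomial of parameter `F(a)`: it vanishes at `a`, so its
    -- other zeros lie in the open arc. From each of its zeros `b` is seen before `z`, so from
    -- `F(a)` the value `F(b)` is seen before `F(z) = c`, against `hpos`.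
    have hra : (popuc ν m (blaschke ν (m + 1) a)).IsRoot a := (h.popuc_isRoot_iff ha).2 rfl
    have hnb : ¬ (popuc ν m (blaschke ν (m + 1) a)).IsRoot b := fun hr =>
      h.ne (h.popuc_roots_outside_unique hFa hra hr haO hbO)
    have hnz : ¬ (popuc ν m (blaschke ν (m + 1) a)).IsRoot z := fun hr =>
      hza (h.popuc_roots_outside_unique hFa hr hra hzO haO)
    obtain ⟨w, hw, hquad⟩ := h.exists_quadrature m hFa
    have hlt : halfCot (blaschke ν (m + 1) a) (blaschke ν (m + 1) b) <
        halfCot (blaschke ν (m + 1) a) (blaschke ν (m + 1) z) := by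
      rw [hquad z hz1 hnz, hquad b hb hnb]
      refine Finset.sum_lt_sum_of_nonempty (hnonempty _) fun ζ hζ => ?_
      have hr := hmem _ ζ hζ
      have hζ1 := h.norm_of_popuc_isRoot hFa hr
      refine mul_lt_mul_of_pos_left ?_ (hw ζ hζ)
      rw [halfCot_lt_iff hz1 hb hζ1 (by rintro rfl; exact hnz hr) (by rintro rfl; exact hnb hr),
        orient_swap_left]
      rw [Left.neg_pos_iff]
      by_cases hζa : ζ = a
      · rwa [hζa]
      · have hζO : ζ ∈ openArc a b := by
          by_contra hζO
          exact hζa (h.popuc_roots_outside_unique hFa hr hra hζO haO)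
        exact orient_neg_of_pos_of_neg ha hb hζ1 hz1 ((mem_openArc_iff ha hb hζ1).1 hζO) hzneg
    rw [halfCot_lt_iff (h.norm_blaschke (m + 1) hz1) hFb hFa
      (fun he => hnz ((h.popuc_isRoot_iff hz1).2 he))
      (fun he => hnb ((h.popuc_isRoot_iff hb).2 he)), hFz, orient_swap_left] at hlt
    linarith

end ArcMeasure

/-! ### The modified measure -/

lemma arcMeasure_of_support_infinite {μ : Measure ℂ} {a b : ℂ} (ha : ‖a‖ = 1) (hb : ‖b‖ = 1)
    (hab : a ≠ b) (hμ : μ (closedArc a b)ᶜ = 0) (hinf : μ.support.Infinite) :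
    ArcMeasure μ a b :=
  ⟨ha, hb, hab, hμ, fun _ hT h0 =>
    hinf (hT.subset (Measure.support_subset_of_isClosed hT.isClosed h0))⟩

section Modified

variable {μ : Measure ℂ} {a b s : ℂ}

lemma continuous_modifiedDensity (a b s : ℂ) :
    Continuous fun z : ℂ => s * (z - a) * (z - b) * conj z := by
  fun_prop

lemma modifiedDensity_nonneg (ha : ‖a‖ = 1) (hb : ‖b‖ = 1)
    (hpos : ∀ z ∈ openArc a b, 0 < s * (z - a) * (z - b) * conj z) {z : ℂ}
    (hz : z ∈ closedArc a b) : 0 ≤ s * (z - a) * (z - b) * conj z := by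
  rcases (mem_closedArc_iff ha hb).1 hz with rfl | rfl | hz
  · simp
  · simp
  · exact (hpos z hz).le

lemma isFiniteMeasure_modifiedMeasure [IsFiniteMeasure μ] (h : ArcMeasure μ a b) (s : ℂ) :
    IsFiniteMeasure (modifiedMeasure μ a b s) :=
  isFiniteMeasure_withDensity_ofReal
    (h.integrable (continuous_modifiedDensity a b s)).re.hasFiniteIntegral

/-- Within the arc the density vanishes only at `a` and `b`, so a finite carrier `T` of the modified
measure would give the finite carrier `T ∪ {a, b}` of `μ`. -/
lemma arcMeasure_modifiedMeasure (h : ArcMeasure μ a b)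
    (hpos : ∀ z ∈ openArc a b, 0 < s * (z - a) * (z - b) * conj z) :
    ArcMeasure (modifiedMeasure μ a b s) a b := by
  refine ⟨h.norm_left, h.norm_right, h.ne,
    withDensity_absolutelyContinuous μ _ h.carrier, fun T hT h0 => ?_⟩
  have hmeas : Measurable fun z : ℂ =>
      ENNReal.ofReal (s * (z - a) * (z - b) * conj z).re :=
    (Complex.continuous_re.comp (continuous_modifiedDensity a b s)).measurable.ennreal_ofReal
  rw [modifiedMeasure, withDensity_apply_eq_zero hmeas] at h0
  refine h.infinite (T ∪ {a, b}) (hT.union (Set.toFinite _)) ?_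
  have h1 : μ ((closedArc a b)ᶜ ∪
      ({z | ENNReal.ofReal (s * (z - a) * (z - b) * conj z).re ≠ 0} ∩ Tᶜ)) = 0 :=
    measure_union_null h.carrier h0
  refine measure_mono_null (fun z hz => ?_) h1
  simp only [Set.mem_compl_iff, Set.mem_union, Set.mem_insert_iff, Set.mem_singleton_iff,
    not_or] at hz
  by_cases hzc : z ∈ closedArc a b
  · right
    refine ⟨?_, hz.1⟩
    rcases (mem_closedArc_iff h.norm_left h.norm_right).1 hzc with hza | hzb | hzo
    · exact absurd hza hz.2.1
    · exact absurd hzb hz.2.2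
    · exact (ENNReal.ofReal_pos.2 (Complex.pos_iff.1 (hpos z hzo)).1).ne'
  · exact Or.inl hzc

lemma innerProd_modifiedMeasure (h : ArcMeasure μ a b)
    (hpos : ∀ z ∈ openArc a b, 0 < s * (z - a) * (z - b) * conj z) (P R : ℂ[X]) :
    innerProd (modifiedMeasure μ a b s) P R =
      s * innerProd μ ((X - C a) * (X - C b) * P) (X * R) := by
  have hmeas : Measurable fun z : ℂ =>
      ENNReal.ofReal (s * (z - a) * (z - b) * conj z).re :=
    (Complex.continuous_re.comp (continuous_modifiedDensity a b s)).measurable.ennreal_ofReal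
  unfold innerProd
  rw [modifiedMeasure, integral_withDensity_eq_integral_toReal_smul hmeas (by simp),
    ← integral_const_mul]
  refine integral_congr_ae (h.ae_mem.mono fun z hz => ?_)
  have hd := Complex.nonneg_iff.1 (modifiedDensity_nonneg h.norm_left h.norm_right hpos hz)
  have hre : (((s * (z - a) * (z - b) * conj z).re : ℝ) : ℂ) = s * (z - a) * (z - b) * conj z :=
    Complex.ext (by simp) (by simpa using hd.2)
  simp only [ENNReal.toReal_ofReal hd.1, Complex.real_smul, hre, eval_mul, eval_sub, eval_X, eval_C,
    map_mul]
  ring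

end Modified

/-! ### The polynomial `Q_{n,3}` and its factorization -/

namespace ArcMeasure

variable {μ : Measure ℂ} {a b : ℂ} [IsFiniteMeasure μ]

lemma innerProd_recip_rho_one_ne_zero (h : ArcMeasure μ a b) (m : ℕ) :
    innerProd μ (recip m (rho μ m)) 1 ≠ 0 := by
  have h1 := h.innerProd_recip_X_pow (natDegree_rho μ m).le (Nat.zero_le m)
  rw [pow_zero, Nat.sub_zero, ← innerProd_conj_symm μ (rho μ m),
    h.innerProd_rho_monic (monic_X_pow m) (natDegree_X_pow m), innerProd_conj_symm] at h1
  rw [h1]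
  exact h.innerProd_self_ne_zero (rho_monic μ m).ne_zero

/-- The quotient `ρ_m / ρ_m^*` takes different values at the ends of the arc. -/
lemma rho_div_recip_ne (h : ArcMeasure μ a b) {m : ℕ} (hm : 1 ≤ m) :
    (rho μ m).eval a / (recip m (rho μ m)).eval a ≠
      (rho μ m).eval b / (recip m (rho μ m)).eval b := by
  intro he
  have ha := h.norm_left
  have hb := h.norm_right
  have hsa := h.recip_rho_eval_ne_zero m ha
  have hsb := h.recip_rho_eval_ne_zero m hb
  obtain ⟨c, hc⟩ : ∃ c, c = (rho μ m).eval a / (recip m (rho μ m)).eval a := ⟨_, rfl⟩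
  -- If the two values were equal to `c`, this `P` would vanish at `a` and `b` while being
  -- orthogonal to `z, …, z^(m-1)`, against the constant phase of `(z - a)(z - b) conj z` on the
  -- arc.
  set P := rho μ m - C c * recip m (rho μ m) with hP
  have hroot : ∀ z, (recip m (rho μ m)).eval z ≠ 0 →
      c = (rho μ m).eval z / (recip m (rho μ m)).eval z → P.IsRoot z := by
    intro z hz hcz
    rw [eq_div_iff hz] at hcz
    simp [hP, hcz]
  have hinner : ∀ k, innerProd μ P (X ^ k) =
      innerProd μ (rho μ m) (X ^ k) - c * innerProd μ (recip m (rho μ m)) (X ^ k) := fun k => by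
    rw [hP, h.innerProd_sub_left, innerProd_C_mul_left]
  obtain ⟨g, hg⟩ := exists_factor_of_two_roots (hroot a hsa hc) (hroot b hsb (hc.trans he)) h.ne
  have hg0 : g ≠ 0 := by
    rintro rfl
    rw [mul_zero] at hg
    have h1 := hinner 0
    rw [hg, innerProd_zero_left, h.innerProd_rho_X_pow (by omega), zero_sub, eq_comm, neg_eq_zero,
      pow_zero] at h1
    have hc0 : c = 0 := (mul_eq_zero.1 h1).resolve_right (h.innerProd_recip_rho_one_ne_zero m)
    rw [hP, hc0] at hg
    exact (rho_monic μ m).ne_zero (by simpa using hg)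
  refine h.innerProd_two_roots_ne_zero ha hb h.ne (left_notMem_openArc ha hb)
    (right_notMem_openArc ha hb) hg0 ?_
  rw [← hg]
  have hdeg : P.natDegree ≤ m := by
    rw [hP]
    simpa using natDegree_sub_le_of_le (natDegree_rho μ m).le
      (natDegree_C_mul_recip_rho_le μ m c)
  rw [hg, natDegree_mul (mul_ne_zero (X_sub_C_ne_zero _) (X_sub_C_ne_zero _)) hg0,
    natDegree_mul (X_sub_C_ne_zero _) (X_sub_C_ne_zero _), natDegree_X_sub_C,
    natDegree_X_sub_C] at hdeg
  refine h.innerProd_eq_zero_of_coeff _ fun k hk => ?_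
  have hk0 : k ≠ 0 := by rintro rfl; exact hk (by simp)
  have hkm := le_natDegree_of_ne_zero hk
  rw [natDegree_X_mul hg0] at hkm
  rw [hinner, h.innerProd_rho_X_pow (by omega), h.innerProd_recip_rho_X_pow (by omega) (by omega)]
  simp

lemma isMonicQPOPUC_Qn3 (h : ArcMeasure μ a b) (m : ℕ) (η : ℂ) {τ : ℂ} (hτ : ‖τ‖ = 1) :
    IsMonicQPOPUC μ (m + 2) 1 τ (Qn3 μ (m + 2) η τ) := by
  have hm1 : (X * (X - C η) * rho μ m).Monic :=
    (monic_X.mul (monic_X_sub_C η)).mul (rho_monic μ m)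
  have hd1 : (X * (X - C η)).natDegree = 1 + 1 := by
    rw [natDegree_X_mul (X_sub_C_ne_zero η), natDegree_X_sub_C]
  have hn1 : (X * (X - C η) * rho μ m).natDegree = m + 2 := by
    rw [natDegree_mul (mul_ne_zero X_ne_zero (X_sub_C_ne_zero η)) (rho_monic μ m).ne_zero, hd1,
      natDegree_rho]
    omega
  have hlin : (1 - C (conj η) * X).natDegree ≤ 1 := by
    rw [← recip_X_sub_C]
    exact natDegree_recip_le (natDegree_X_sub_C η).le
  have hrd := natDegree_recip_le (natDegree_rho μ m).le
  have hn2 : (C τ * (1 - C (conj η) * X) * recip m (rho μ m)).natDegree ≤ m + 1 := by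
    refine natDegree_mul_le.trans ?_
    have := (natDegree_C_mul_le τ (1 - C (conj η) * X)).trans hlin
    omega
  have hQ : Qn3 μ (m + 2) η τ = X * (X - C η) * rho μ m +
      C τ * (1 - C (conj η) * X) * recip m (rho μ m) := rfl
  refine ⟨?_, ?_, hτ, ?_, ?_⟩
  · rw [hQ]
    refine hm1.add_of_left (degree_lt_degree ?_)
    omega
  · rw [hQ, natDegree_add_eq_left_of_natDegree_lt, hn1]
    omega
  · have r1 : recip (1 + 1 + m) (X * (X - C η) * rho μ m) =
        (1 - C (conj η) * X) * recip m (rho μ m) := by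
      rw [recip_mul hd1.le (natDegree_rho μ m).le, recip_mul natDegree_X_le
        (natDegree_X_sub_C η).le, recip_X, recip_X_sub_C, one_mul]
    have r2 : recip (1 + 1 + m) ((1 - C (conj η) * X) * recip m (rho μ m)) =
        X * (X - C η) * rho μ m := by
      rw [← r1, recip_recip]
    have hCC : C τ * C (conj τ) = 1 := by rw [← C_mul, mul_conj_of_norm hτ, C_1]
    rw [hQ, show m + 2 = 1 + 1 + m by omega, recip_add, r1, mul_assoc (C τ), recip_C_mul, r2]
    linear_combination (-(X * (X - C η) * rho μ m)) * hCC
  · intro k hk hkn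
    obtain ⟨j, rfl⟩ := Nat.exists_eq_add_of_le hk
    -- The four terms are orthogonal to `z^k` for `k` in `[2, m+1]`, `[1, m]`, `[1, m]`, `[2, m+1]`
    -- respectively; the common range is `[2, m]`.
    have e : Qn3 μ (m + 2) η τ = X * (X * rho μ m) - C η * (X * rho μ m) +
        C τ * recip m (rho μ m) - C (τ * conj η) * (X * recip m (rho μ m)) := by
      rw [hQ, C_mul]; ring
    have p2 : (X : ℂ[X]) ^ (1 + 1 + j) = X * (X * X ^ j) := by ring
    have p1 : (X : ℂ[X]) ^ (j + 1) = X * X ^ j := by ring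
    rw [e, h.innerProd_sub_left, h.innerProd_add_left, h.innerProd_sub_left, innerProd_C_mul_left,
      innerProd_C_mul_left, innerProd_C_mul_left,
      h.innerProd_recip_rho_X_pow (by omega) (by omega), p2, h.innerProd_X_mul_X_mul,
      h.innerProd_X_mul_X_mul, h.innerProd_X_mul_X_mul, h.innerProd_X_mul_X_mul, ← p1,
      h.innerProd_rho_X_pow (by omega), h.innerProd_rho_X_pow (by omega),
      h.innerProd_recip_rho_X_pow (by omega) (by omega)]
    simp

lemma Qn3_isRoot (h : ArcMeasure μ a b) (m : ℕ) {η τ z : ℂ} (hz : ‖z‖ = 1)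
    (he : (z - η) * blaschke μ (m + 1) z + τ * (1 - conj η * z) = 0) :
    (Qn3 μ (m + 2) η τ).IsRoot z := by
  have hs := h.recip_rho_eval_ne_zero m hz
  have hF : blaschke μ (m + 1) z * (recip m (rho μ m)).eval z = z * (rho μ m).eval z := by
    rw [blaschke, Nat.add_sub_cancel, div_mul_cancel₀ _ hs]
  simp only [Qn3, Nat.add_sub_cancel, IsRoot.def, eval_add, eval_mul, eval_sub, eval_X, eval_C,
    eval_one]
  linear_combination ((recip m (rho μ m)).eval z) * he - (z - η) * hF

end ArcMeasure

/-- The parameter `η` prescribing zeros at `a` and `b` solves the two interpolation conditions. -/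
lemma prescribed_zero_param {a b A B τ c₁₂ a₁₂ η : ℂ} (ha : ‖a‖ = 1) (hb : ‖b‖ = 1) (hA : ‖A‖ = 1)
    (hB : ‖B‖ = 1) (hτ : ‖τ‖ = 1) (hne : a * conj A ≠ b * conj B)
    (hc : conj c₁₂ = (conj A - conj B) / (a * conj A - b * conj B))
    (ha₁₂ : conj a₁₂ = (a - b) / (a * conj A - b * conj B))
    (hη : η = c₁₂ + a * b * (conj (a * b) * τ) * a₁₂) :
    (a - η) * A + τ * (1 - conj η * a) = 0 ∧ (b - η) * B + τ * (1 - conj η * b) = 0 := by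
  have hab : a * b * conj (a * b) = 1 := mul_conj_of_norm (by rw [norm_mul, ha, hb, one_mul])
  have hη' : η = c₁₂ + τ * a₁₂ := by rw [hη]; linear_combination (τ * a₁₂) * hab
  have hD : a * conj A - b * conj B ≠ 0 := sub_ne_zero.2 hne
  have hcη : conj η * (a * conj A - b * conj B) = conj A - conj B + conj τ * (a - b) := by
    rw [hη', map_add, map_mul, hc, ha₁₂, ← mul_div_assoc, ← add_div, div_mul_cancel₀ _ hD]
  have hη2 := congrArg conj hcη
  simp only [map_mul, map_sub, map_add, Complex.conj_conj] at hη2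
  have a0 := ne_zero_of_norm ha
  have b0 := ne_zero_of_norm hb
  have A0 := ne_zero_of_norm hA
  have B0 := ne_zero_of_norm hB
  have τ0 := ne_zero_of_norm hτ
  -- Up to the factor `τ`, this is the determinant of the two conditions seen as a linear system in
  -- `η` and `conj η`; up to a nonzero factor it is also the denominator in `hne`.
  have hE : A * b - B * a ≠ 0 := by
    intro hE
    apply hne
    rw [conj_eq_inv_of_norm hA, conj_eq_inv_of_norm hB]
    field_simp
    linear_combination -hE
  rw [conj_eq_inv_of_norm ha, conj_eq_inv_of_norm hb] at hη2
  rw [conj_eq_inv_of_norm hA, conj_eq_inv_of_norm hB, conj_eq_inv_of_norm hτ] at hcη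
  -- From here `η` and its conjugate are independent unknowns and the claim is pure algebra.
  generalize conj η = η' at *
  field_simp at hη2 hcη
  constructor
  · refine (mul_eq_zero.1 (?_ : (A * b - B * a) * _ = 0)).resolve_left hE
    linear_combination (-A) * hη2 + a * hcη
  · refine (mul_eq_zero.1 (?_ : (A * b - B * a) * _ = 0)).resolve_left hE
    linear_combination (-B) * hη2 + b * hcη

/-- The factor of `Q_{n,3}` complementary to the zeros `a` and `b` is paraorthogonal for the
modified measure. -/
lemma cofactor_eq_popuc {μ : Measure ℂ} [IsFiniteMeasure μ] {a b s τ : ℂ} (h : ArcMeasure μ a b)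
    (hpos : ∀ z ∈ openArc a b, 0 < s * (z - a) * (z - b) * conj z) {k : ℕ} {Q R : ℂ[X]}
    (hQ : IsMonicQPOPUC μ (k + 3) 1 τ Q) (hQR : Q = (X - C a) * (X - C b) * R) :
    R = popuc (modifiedMeasure μ a b s) k (-(conj (a * b) * τ)) := by
  have hfin := isFiniteMeasure_modifiedMeasure h s
  have hhat := arcMeasure_modifiedMeasure h hpos
  have hab0 : (X - C a) * (X - C b) ≠ 0 := mul_ne_zero (X_sub_C_ne_zero a) (X_sub_C_ne_zero b)
  have hRm : R.Monic :=
    ((monic_X_sub_C a).mul (monic_X_sub_C b)).of_mul_monic_left (hQR ▸ hQ.monic)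
  have hd2 : ((X - C a) * (X - C b)).natDegree = 1 + 1 := by
    rw [natDegree_mul (X_sub_C_ne_zero _) (X_sub_C_ne_zero _), natDegree_X_sub_C,
      natDegree_X_sub_C]
  have hRd : R.natDegree = k + 1 := by
    have := hQ.natDegree_eq
    rw [hQR, natDegree_mul hab0 hRm.ne_zero, hd2] at this
    omega
  have hRinv : R = C (conj (a * b) * τ) * recip (k + 1) R := by
    have h1 := hQ.invariant
    rw [hQR, show k + 3 = 1 + 1 + (k + 1) by omega, recip_mul hd2.le hRd.le,
      recip_mul (natDegree_X_sub_C a).le (natDegree_X_sub_C b).le, recip_X_sub_C,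
      recip_X_sub_C] at h1
    refine mul_left_cancel₀ hab0 (h1.trans ?_)
    have ea : C a * C (conj a) = 1 := by rw [← C_mul, mul_conj_of_norm h.norm_left, C_1]
    have eb : C b * C (conj b) = 1 := by rw [← C_mul, mul_conj_of_norm h.norm_right, C_1]
    have e : (1 - C (conj a) * X) * (1 - C (conj b) * X) =
        C (conj a) * C (conj b) * ((X - C a) * (X - C b)) := by
      linear_combination (-(1 - C (conj b) * X)) * ea -
        C (conj a) * (C a - X) * eb
    rw [e, C_mul, map_mul conj, C_mul]
    ring
  -- Invariance enters only through this constant coefficient, which fixes the parameter.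
  have hR0 : R.coeff 0 = conj (a * b) * τ := by
    rw [hRinv, coeff_C_mul, recip_coeff_zero]
    rw [Monic, leadingCoeff, hRd] at hRm
    rw [hRm]; simp
  obtain ⟨c, hc⟩ : ∃ c, c = -(conj (a * b) * τ) := ⟨_, rfl⟩
  rw [← hc]
  by_contra hne
  -- The difference of the two monic polynomials has degree at most `k` and no constant term, and it
  -- is orthogonal to `z, …, z^k`; hence it is orthogonal to itself.
  have hD0 := sub_ne_zero.2 hne
  refine hhat.innerProd_self_ne_zero hD0 (hhat.innerProd_eq_zero_of_coeff _ fun j hj => ?_)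
  have hj0 : j ≠ 0 := by
    rintro rfl
    exact hj (by rw [coeff_sub, hR0, popuc_coeff_zero, hc]; ring)
  have hjk : j ≤ k := by
    have hlt : (R - popuc (modifiedMeasure μ a b s) k c).degree < R.degree := by
      refine degree_sub_lt_left ?_ hRm.ne_zero ?_
      · rw [degree_eq_natDegree hRm.ne_zero, degree_eq_natDegree (popuc_monic _ _ _).ne_zero, hRd,
          natDegree_popuc]
      · rw [hRm.leadingCoeff, (popuc_monic _ _ _).leadingCoeff]
    have h1 := natDegree_lt_natDegree hD0 hlt
    have h2 := le_natDegree_of_ne_zero hj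
    omega
  rw [hhat.innerProd_sub_left, innerProd_modifiedMeasure h hpos, ← hQR, ← pow_succ',
    hQ.orthogonal (j + 1) (by omega) (by omega), hhat.innerProd_popuc_eq_zero c (by
      rwa [natDegree_X_pow]) (by rw [coeff_X_pow, if_neg hj0.symm])]
  simp

/-- Simplicity at `a` and `b` forbids the cofactor to vanish there, which is why the closed arc on
the left becomes the open arc on the right. -/
lemma allZerosSimpleIn_iff {μ : Measure ℂ} [IsFiniteMeasure μ] {a b c : ℂ} (h : ArcMeasure μ a b)
    (hc : ‖c‖ = 1) {k : ℕ} {Q : ℂ[X]} (hQ : Q = (X - C a) * (X - C b) * popuc μ k c) :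
    AllZerosSimpleIn Q (closedArc a b) ↔ ∀ z, (popuc μ k c).IsRoot z → z ∈ openArc a b := by
  have hR0 := (popuc_monic μ k c).ne_zero
  have hab0 : (X - C a) * (X - C b) ≠ 0 := mul_ne_zero (X_sub_C_ne_zero a) (X_sub_C_ne_zero b)
  have hQ0 : Q ≠ 0 := hQ ▸ mul_ne_zero hab0 hR0
  have hroots : Q.roots = a ::ₘ b ::ₘ (popuc μ k c).roots := by
    rw [hQ, roots_mul (hQ ▸ hQ0), roots_mul hab0, roots_X_sub_C, roots_X_sub_C,
      add_assoc, Multiset.singleton_add, Multiset.singleton_add]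
  constructor
  · intro hall z hz
    have hzR : z ∈ (popuc μ k c).roots := (mem_roots hR0).2 hz
    have hzQ : z ∈ Q.roots := by rw [hroots]; simp [hzR]
    obtain ⟨h1, h2⟩ := hall z ((mem_roots hQ0).1 hzQ)
    have hcount := Multiset.one_le_count_iff_mem.2 hzR
    rw [← count_roots, hroots, Multiset.count_cons, Multiset.count_cons] at h1
    rcases (mem_closedArc_iff h.norm_left h.norm_right).1 h2 with hza | hzb | hzo
    · rw [if_pos hza] at h1; omega
    · rw [if_pos hzb] at h1; omega
    · exact hzo
  · intro hall z hz
    have hnodup : Q.roots.Nodup := by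
      rw [hroots, Multiset.nodup_cons, Multiset.nodup_cons, Multiset.mem_cons, mem_roots hR0,
        mem_roots hR0]
      refine ⟨?_, fun hb => ?_, h.nodup_roots_popuc hc⟩
      · rintro (he | hr)
        · exact h.ne he
        · exact left_notMem_openArc h.norm_left h.norm_right (hall a hr)
      · exact right_notMem_openArc h.norm_left h.norm_right (hall b hb)
    have hzQ := (mem_roots hQ0).2 hz
    refine ⟨?_, ?_⟩
    · rw [← count_roots]
      exact Multiset.count_eq_one_of_mem hnodup hzQ
    · rw [hroots, Multiset.mem_cons, Multiset.mem_cons, mem_roots hR0] at hzQ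
      refine (mem_closedArc_iff h.norm_left h.norm_right).2 ?_
      exact hzQ.imp_right (Or.imp_right (hall z))

end QPOPUC

end

open QPOPUC

theorem theorem3p8
    (μ : Measure ℂ) [IsFiniteMeasure μ]
    (a b : ℂ) (ha : ‖a‖ = 1) (hb : ‖b‖ = 1) (hab : a ≠ b)
    -- `μ` is carried by the arc `[a, b]` and is not a finite sum of point masses
    (hμ : μ (closedArc a b)ᶜ = 0) (hinf : μ.support.Infinite)
    -- the square root of `conj (a b)` for which the modified measure is positive on `(a, b)`
    (s : ℂ) (hs : s ^ 2 = conj (a * b))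
    (hpos : ∀ z ∈ openArc a b, 0 < s * (z - a) * (z - b) * conj z)
    (μhat : Measure ℂ) (hμhat : μhat = modifiedMeasure μ a b s)
    (n : ℕ) (hn : 3 ≤ n)
    (τ τhat : ℂ) (hτ : ‖τ‖ = 1) (hτhat : τhat = conj (a * b) * τ)
    (fa fb : ℂ) (hfa : fa = conj (blaschke μ (n - 1) a)) (hfb : fb = conj (blaschke μ (n - 1) b))
    (c₁₂ a₁₂ η : ℂ)
    (hc : conj c₁₂ = (fa - fb) / (a * fa - b * fb))
    (ha₁₂ : conj a₁₂ = (a - b) / (a * fa - b * fb))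
    (hη : η = c₁₂ + a * b * τhat * a₁₂)
    (Q : ℂ[X]) (hQ : Q = Qn3 μ n η τ) :
    -- the parameter `η` is well defined and `Q` is a monic quasi-paraorthogonal polynomial
    a * fa ≠ b * fb ∧ IsMonicQPOPUC μ n 1 τ Q ∧
    -- two prescribed zeros
    ((AllZerosSimpleIn Q (closedArc a b) ∧ Q.IsRoot a ∧ Q.IsRoot b) ↔
      -τhat ∈ openArc (blaschke μhat (n - 2) a) (blaschke μhat (n - 2) b)) ∧
    -- three prescribed zeros
    (∀ α ∈ openArc a b,
      ((AllZerosSimpleIn Q (closedArc a b) ∧ Q.IsRoot a ∧ Q.IsRoot b ∧ Q.IsRoot α) ↔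
        (-τhat = blaschke μhat (n - 2) α ∧
          blaschke μhat (n - 2) α ∈
            openArc (blaschke μhat (n - 2) a) (blaschke μhat (n - 2) b)))) := by
  -- The cofactor has degree `n - 2 = k + 1`, so it is built from `ρ̂_k`, and its Blaschke product
  -- is `F̂_{k+1}`.
  obtain ⟨k, rfl⟩ : ∃ k, n = k + 3 := ⟨n - 3, by omega⟩
  rw [show k + 3 - 1 = k + 1 + 1 by omega] at hfa hfb
  rw [show k + 3 - 2 = k + 1 by omega]
  have h := arcMeasure_of_support_infinite ha hb hab hμ hinf
  have hfin : IsFiniteMeasure μhat := hμhat ▸ isFiniteMeasure_modifiedMeasure h s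
  have hhat : ArcMeasure μhat a b := hμhat ▸ arcMeasure_modifiedMeasure h hpos
  have hne : a * fa ≠ b * fb := by
    intro he
    -- The factor `z` of the Blaschke product cancels on the circle, so `a fa = b fb` compares `ρ /
    -- ρ^*` at the two endpoints.
    have key : ∀ z, ‖z‖ = 1 → z * conj (blaschke μ (k + 1 + 1) z) =
        conj ((rho μ (k + 1)).eval z / (recip (k + 1) (rho μ (k + 1))).eval z) := by
      intro z hz
      rw [blaschke, Nat.add_sub_cancel, mul_div_assoc, map_mul, ← mul_assoc, mul_conj_of_norm hz,
        one_mul]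
    rw [hfa, hfb, key a ha, key b hb] at he
    exact h.rho_div_recip_ne (by omega) ((starRingEnd ℂ).injective he)
  have hQP : IsMonicQPOPUC μ (k + 3) 1 τ Q := hQ ▸ h.isMonicQPOPUC_Qn3 (k + 1) η hτ
  have hparam : Q.IsRoot a ∧ Q.IsRoot b := by
    rw [hfa, hfb] at hne hc ha₁₂
    rw [hτhat] at hη
    obtain ⟨h1, h2⟩ := prescribed_zero_param ha hb (h.norm_blaschke _ ha) (h.norm_blaschke _ hb) hτ
      hne hc ha₁₂ hη
    rw [hQ]
    exact ⟨h.Qn3_isRoot (k + 1) ha h1, h.Qn3_isRoot (k + 1) hb h2⟩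
  obtain ⟨hQa, hQb⟩ := hparam
  obtain ⟨R, hQR⟩ := exists_factor_of_two_roots hQa hQb hab
  have hR : R = popuc μhat k (-τhat) := by
    rw [hτhat, hμhat]
    exact cofactor_eq_popuc h hpos hQP hQR
  have hτhat1 : ‖-τhat‖ = 1 := by
    rw [norm_neg, hτhat, norm_mul, Complex.norm_conj, norm_mul, ha, hb, hτ]; norm_num
  rw [hR] at hQR
  have hmain : AllZerosSimpleIn Q (closedArc a b) ↔
      -τhat ∈ openArc (blaschke μhat (k + 1) a) (blaschke μhat (k + 1) b) :=
    (allZerosSimpleIn_iff hhat hτhat1 hQR).trans (hhat.popuc_roots_mem_openArc_iff k hτhat1)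
  refine ⟨hne, hQP, ?_, fun α hα => ?_⟩
  · rw [← hmain]
    exact ⟨fun hz => hz.1, fun hz => ⟨hz, hQa, hQb⟩⟩
  · have hα1 : ‖α‖ = 1 :=
      norm_of_mem_closedArc ha ((mem_closedArc_iff ha hb).2 (Or.inr (Or.inr hα)))
    have hQα : Q.IsRoot α ↔ blaschke μhat (k + 1) α = -τhat := by
      rw [← hhat.popuc_isRoot_iff hα1, hQR, root_mul, root_mul, root_X_sub_C, root_X_sub_C]
      refine ⟨fun hr => ?_, Or.inr⟩
      rcases hr with (rfl | rfl) | hr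
      · exact absurd hα (left_notMem_openArc ha hb)
      · exact absurd hα (right_notMem_openArc ha hb)
      · exact hr
    constructor
    · rintro ⟨h1, -, -, h2⟩
      have h3 := hQα.1 h2
      exact ⟨h3.symm, h3 ▸ hmain.1 h1⟩
    · rintro ⟨h1, h2⟩
      exact ⟨hmain.2 (h1 ▸ h2), hQa, hQb, hQα.2 h1.symm⟩
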